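/- **Dot product estimation.** Circuits act on a finite number of qubits and consist of Hadamard gates, Toffoli gates, computational-basis measurements of single qubits, and postselection of a single qubit on $|1\rangle$; each of these may occur anywhere in the circuit. A measurement of qubit $i$ in the state $\varphi$ has outcome $r$ with probability $\|\Pi_r\varphi\|^2/\|\varphi\|^2$ and leaves the state $\Pi_r\varphi/\|\Pi_r\varphi\|$; postselection on qubit $i$ replaces the current state $\varphi$ (in particular, the current post-measurement state) by $\Pi_1\varphi/\|\Pi_1\varphi\|$ and is undefined if $\Pi_1\varphi=0$. At the end all qubits are measured, and designated output qubits with outcomes $b_1,\dots,b_m$ are read as the number $v=0.b_1b_2\dots b_m\in[0,1]$ in binary. A family $(C_\ell)_{\ell\in\mathbb N}$ of such circuits is a uniform family of polynomial-size PostBQP circuits if the numbers of qubits and of gates are bounded by a polynomial in $\ell$ and a polynomial-time Turing machine writes down $C_\ell$ on input $1^\ell$. There is a constant $c>0$ such that for every polynomial $b$ with coefficients in $\mathbb N$ there are a polynomial $k$ with coefficients in $\mathbb N$ and a uniform family $(C_\ell)_{\ell\in\mathbb N}$ of polynomial-size PostBQP circuits with the following property. Let $\ell\in\mathbb N$, and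 let $|\psi\rangle=\gamma_1|0\rangle+\gamma_2|1\rangle$ with $\gamma_1,\gamma_2\in\mathbb R$, $\gamma_1^2+\gamma_2^2=1$ and $|\gamma_1|,|\gamma_2|\in\{0\}\cup(2^{-\ell},2^{\ell})$. Let $|\psi'\rangle=(\alpha_1+i\alpha_2)|0\rangle+(\alpha_3+i\alpha_4)|1\rangle$ be a vector, not necessarily normalized, where each $\alpha_j$ is a signed binary fixed-point number with $b(\ell)$ integer bits and $b(\ell)$ fractional bits, and suppose that $|\langle\psi|\psi'\rangle|^2\le 1+2^{-\ell}$. If $C_\ell$ is run on $k(\ell)$ copies of $|\psi\rangle$, the $4(2b(\ell)+1)$-bit string that describes $|\psi'\rangle$, and ancilla qubits $|0\rangle$, then with probability $1$ every postselection is well defined, and the output $v\in[0,1]$ satisfies $$\Pr\Big[\,\big|v-|\langle\psi|\psi'\rangle|^2\big|\le 2^{-c\ell}\,\Big]\ \ge\ 1-2^{-c\ell}.$$ -/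

import Mathlib

namespace PostBQP

/-- A (not necessarily normalized) state vector of `n` qubits, given by its amplitudes in the
computational basis. A nonzero vector represents the physical state on its ray. -/
abbrev State (n : ℕ) : Type := (Fin n → Bool) → ℂ

/-- The squared Euclidean norm of a state vector. -/
noncomputable def normSq {n : ℕ} (φ : State n) : ℝ := ∑ x, ‖φ x‖ ^ 2

/-- The Hadamard gate on qubit `i`. -/
noncomputable def applyHadamard {n : ℕ} (i : Fin n) (φ : State n) : State n := fun x =>
  (φ (Function.update x i false) + (if x i then -1 else 1) * φ (Function.update x i true)) /
    (Real.sqrt 2 : ℂ)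

/-- The Toffoli gate with controls `a`, `b` and target `t`. -/
def applyToffoli {n : ℕ} (a b t : Fin n) (φ : State n) : State n := fun x =>
  φ (Function.update x t (xor (x t) (x a && x b)))

/-- The projection of a state vector onto the subspace where qubit `i` is `|r⟩`. -/
def project {n : ℕ} (i : Fin n) (r : Bool) (φ : State n) : State n := fun x =>
  if x i = r then φ x else 0

/-- The instructions of a quantum circuit with postselection on `n` qubits: the gates Hadamard and
Toffoli, a measurement of a qubit in the computational basis, and postselection on a qubit
being `|1⟩`. -/
inductive Gate (n : ℕ) : Type
  | hadamard (i : Fin n)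
  | toffoli (a b t : Fin n) (hab : a ≠ b) (hat : a ≠ t) (hbt : b ≠ t)
  | measure (i : Fin n)
  | postselect (i : Fin n)

/-- `outcomeProb gs φ E` is the probability that, when the instructions `gs` are executed in order
on the state `φ` and all qubits are then measured in the computational basis, the final outcome
lies in `E`.

* A measurement has outcome `r` with probability `‖Π_r φ‖² / ‖φ‖²`, and the run continues with the
  corresponding post-measurement state `Π_r φ` (up to normalization).
* Postselection replaces the current state `φ` by `Π_1 φ` (up to normalization). It is undefined
  if `Π_1 φ = 0`; then, as `0 / 0 = 0`, the run contributes to no event. Hence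
  `outcomeProb gs φ Set.univ = 1` says that `φ ≠ 0` and that no undefined postselection occurs with
  positive probability. -/
noncomputable def outcomeProb {n : ℕ} :
    List (Gate n) → State n → Set (Fin n → Bool) → ℝ
  | [], φ, E => normSq (E.indicator φ) / normSq φ
  | .hadamard i :: gs, φ, E => outcomeProb gs (applyHadamard i φ) E
  | .toffoli a b t _ _ _ :: gs, φ, E => outcomeProb gs (applyToffoli a b t φ) E
  | .measure i :: gs, φ, E =>
      ∑ r : Bool, normSq (project i r φ) / normSq φ * outcomeProb gs (project i r φ) E
  | .postselect i :: gs, φ, E => outcomeProb gs (project i true φ) E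

/-- A circuit: its number of qubits, its list of instructions, and the designated output qubits. -/
structure Circuit : Type where
  width : ℕ
  gates : List (Gate width)
  outputs : List (Fin width)

/-- The number `0.b₁b₂…b_m` (in binary) that is read off the output qubits. -/
noncomputable def Circuit.outputValue (C : Circuit) (x : Fin C.width → Bool) : ℝ :=
  C.outputs.foldr (fun i v => ((if x i then 1 else 0) + v) / 2) 0

/-- The alphabet in which circuits are written down. -/
inductive Symbol : Type
  | tick
  | sep
  | hadamard
  | toffoli
  | measure
  | postselect
  | output

/-- A natural number in unary. -/
def ticks (m : ℕ) : List Symbol := List.replicate m Symbol.tick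

/-- The description of an instruction, with qubit numbers in unary. -/
def Gate.encode {n : ℕ} : Gate n → List Symbol
  | .hadamard i => Symbol.hadamard :: ticks i
  | .toffoli a b t _ _ _ =>
      Symbol.toffoli :: (ticks a ++ Symbol.sep :: (ticks b ++ Symbol.sep :: ticks t))
  | .measure i => Symbol.measure :: ticks i
  | .postselect i => Symbol.postselect :: ticks i

/-- The description of a circuit as a string: the number of qubits, the instructions in order, and
the output qubits in order. -/
def Circuit.encode (C : Circuit) : List Symbol :=
  ticks C.width ++ (C.gates.flatMap Gate.encode ++
    C.outputs.flatMap fun i => Symbol.output :: ticks i)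

/-- A uniform family of polynomial-size circuits: a polynomial-time Turing machine, run on `1^ℓ`,
writes down the description of the `ℓ`-th circuit. -/
def IsUniformFamily (C : ℕ → Circuit) : Prop :=
  (∃ p : Polynomial ℕ, ∀ ℓ, (C ℓ).width ≤ p.eval ℓ ∧ (C ℓ).gates.length ≤ p.eval ℓ ∧
    (C ℓ).outputs.length ≤ p.eval ℓ) ∧
  Nonempty (Turing.TM2ComputableInPolyTime Computability.unaryEncodeNat Circuit.encode C)

/-- The vectors of a single qubit. -/
abbrev Qubit : Type := EuclideanSpace ℂ (Fin 2)

/-- The computational basis vectors `|0⟩` and `|1⟩` of a qubit. -/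
noncomputable def ket (r : Bool) : Qubit := EuclideanSpace.single (if r then 1 else 0) 1

/-- The tensor product of single-qubit vectors. -/
noncomputable def productState {n : ℕ} (q : Fin n → Qubit) : State n := fun x =>
  ∏ i, q i (if x i then 1 else 0)

/-- The state `|ψ⟩^{⊗ k} ⊗ |s⟩ ⊗ |0…0⟩` of `n` qubits. -/
noncomputable def inputState (n k : ℕ) (ψ : Qubit) (s : List Bool) : State n :=
  productState fun i => if (i : ℕ) < k then ψ else ket (s.getD (i - k) false)

/-- Signed binary fixed-point numbers with `b` integer bits and `b` fractional bits; the last bit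
is the sign. -/
abbrev FixedPoint (b : ℕ) : Type := Fin (2 * b + 1) → Bool

/-- The real number that a fixed-point number represents. -/
noncomputable def FixedPoint.value {b : ℕ} (s : FixedPoint b) : ℝ :=
  (if s (Fin.last (2 * b)) then -1 else 1) *
    ∑ i : Fin (2 * b), if s i.castSucc then (2 : ℝ) ^ ((i : ℤ) - (b : ℤ)) else 0

/-- The vector `(α₁ + i α₂)|0⟩ + (α₃ + i α₄)|1⟩` described by four fixed-point numbers. It need not
be normalized. -/
noncomputable def describedVector {b : ℕ} (d : Fin 4 → FixedPoint b) : Qubit :=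
  !₂[(⟨(d 0).value, (d 1).value⟩ : ℂ), (⟨(d 2).value, (d 3).value⟩ : ℂ)]

/-- The bit string that consists of the four fixed-point numbers, one after the other. -/
def descriptionBits {b : ℕ} (d : Fin 4 → FixedPoint b) : List Bool :=
  List.ofFn fun t : Fin (4 * (2 * b + 1)) =>
    d (finProdFinEquiv.symm t).1 (finProdFinEquiv.symm t).2

end PostBQP

/-!
The circuit finds the binary digits of `p = |⟨ψ|ψ'⟩|²` one after the other, by binary search. Stage
`j` brings a new qubit into superposition, multiplies the amplitudes of its values `0` and `1` by
`F (-x)` and `F x` up to sign, and measures it. Here `x` is the difference between `p` and the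
threshold `0.v₀…v_{j-1}1`, and `F x = (∏ i, (x + 2⁻ⁱ)) ^ n` is the product by which rational
functions approximate the sign of `x`: for `2^(-ℓ) ≤ x ≤ 2` one of the `n` factors of the product in
`F (-x)` is at most a third of its counterpart in `F x`, and the other ones are not larger
(`abs_prod_sub_le`), so that the wrong digit has probability at most
`9^(-n)` (`jumpProb_false_le`, `jumpProb_true_le`). If `|x| < 2^(-ℓ)`, both digits are acceptable.
Hence the invariant `Close` of the search fails with probability at most `n * 9^(-n)`
(`Close.step`, `le_outcomeProb_stages`), and `n = ℓ + 1` digits are enough.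

A factor `x ± 2⁻ⁱ` is a quadratic form in the amplitudes of `ψ`, whose coefficients are sums of
products of signed bits and powers of `2`. Two fresh copies of `ψ` provide the monomials
(`run_factor`). The coefficients are summed up with postselection: one qubit holds the partial sum
`X` as the vector `|0⟩ + X|1⟩`, and a term is added to `X` in a branch of a selector qubit, whose
amplitude is multiplied by bits, signs, `2` and `1 / 2` (`Weighs`, `Adds`, `Adds.addTerm`).
Postselection of that qubit on `|1⟩` multiplies the state by `X`, and projection of the two copies
to `|0⟩ + |1⟩` adds up the four monomials. All factors that do not depend on the branch are
irrelevant (`outcomeProb_smul`). As `F x` and `F (-x)` do not both vanish, no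
postselection is undefined.

For uniformity, the description of the circuit is written as the value of an expression `Gen` built
from symbols, concatenation, unary variables and loops. Such an expression is turned into a program
on stacks (`Gen.exec_compile`), which a multi-stack Turing machine runs in one step per test of a
loop condition (`StackProg.Exec.simulate`). Its running time is a polynomial that is computed
along with the expression (`Writable.computable`).
-/

namespace PostBQP

/-! ### Stack programs and Turing machines -/

/-- Programs that act on finitely many stacks of symbols, numbered by natural numbers.
`whilePop k p` pops the top of stack `k` and runs `p`, over and over, until stack `k` is empty. -/
inductive StackProg : Type
  | skip
  | push (k : ℕ) (s : Symbol)
  | seq (p q : StackProg)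
  | whilePop (k : ℕ) (p : StackProg)

namespace StackProg

/-- `p.Exec S S' t`: the program `p` turns the stack contents `S` into `S'` and tests a loop
condition `t` times on the way. -/
inductive Exec : StackProg → (ℕ → List Symbol) → (ℕ → List Symbol) → ℕ → Prop
  | skip (S) : Exec skip S S 0
  | push (k s S) : Exec (push k s) S (Function.update S k (s :: S k)) 0
  | seq {p q S S' S'' t t'} (hp : Exec p S S' t) (hq : Exec q S' S'' t') :
      Exec (seq p q) S S'' (t + t')
  | while_nil {k p S} (h : S k = []) : Exec (whilePop k p) S S 1
  | while_cons {k p S S' S'' t t' a l} (h : S k = a :: l)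
      (hp : Exec p (Function.update S k l) S' t) (hw : Exec (whilePop k p) S' S'' t') :
      Exec (whilePop k p) S S'' (t + t' + 1)

/-- The loops of a program; they become the labels of a Turing machine. -/
def Loop : StackProg → Type
  | skip => Empty
  | push _ _ => Empty
  | seq p q => p.Loop ⊕ q.Loop
  | whilePop _ p => Option p.Loop

instance fintypeLoop : (p : StackProg) → Fintype p.Loop
  | skip => inferInstanceAs (Fintype Empty)
  | push _ _ => inferInstanceAs (Fintype Empty)
  | seq p q =>
    letI := fintypeLoop p
    letI := fintypeLoop q
    inferInstanceAs (Fintype (p.Loop ⊕ q.Loop))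
  | whilePop _ p =>
    letI := fintypeLoop p
    inferInstanceAs (Fintype (Option p.Loop))

/-- All stacks that the program touches have a number below `N`. -/
def Bounded (N : ℕ) : StackProg → Prop
  | skip => True
  | push k _ => k < N
  | seq p q => p.Bounded N ∧ q.Bounded N
  | whilePop k p => k < N ∧ p.Bounded N

/-- The alphabets of the machine's stacks: the input stack `none` holds bits, the other stacks hold
symbols. -/
abbrev Alphabet (N : ℕ) : Option (Fin N) → Type
  | none => Bool
  | some _ => Symbol

variable {N : ℕ} [NeZero N] {Λ : Type}

/-- The statement that runs `p` and continues with the statement `c`, where `e` names the labels of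
the loops of `p`. -/
def code : (p : StackProg) → (p.Loop → Λ) → Turing.TM2.Stmt (Alphabet N) Λ Bool →
    Turing.TM2.Stmt (Alphabet N) Λ Bool
  | skip, _, c => c
  | push k s, _, c => .push (some (Fin.ofNat N k)) (fun _ => s) c
  | seq p q, e, c => p.code (fun l => e (.inl l)) (q.code (fun l => e (.inr l)) c)
  | whilePop _ _, e, _ => .goto fun _ => e none

/-- The statements at the labels of the loops of `p`, when `p` is followed by `c`. -/
def table : (p : StackProg) → (p.Loop → Λ) → Turing.TM2.Stmt (Alphabet N) Λ Bool →
    p.Loop → Turing.TM2.Stmt (Alphabet N) Λ Bool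
  | skip, _, _, l => nomatch l
  | push _ _, _, _, l => nomatch l
  | seq p q, e, c, .inl l => p.table (fun l => e (.inl l)) (q.code (fun l => e (.inr l)) c) l
  | seq _ q, e, c, .inr l => q.table (fun l => e (.inr l)) c l
  | whilePop k p, e, c, none =>
      .pop (some (Fin.ofNat N k)) (fun _ o => o.isSome)
        (.branch id (p.code (fun l => e (some l)) (.goto fun _ => e none)) c)
  | whilePop _ p, e, _, some l => p.table (fun l => e (some l)) (.goto fun _ => e none) l

/-- The machine's stacks when the input stack is empty and the other stacks are as in `S`. -/
def toStacks (N : ℕ) (S : ℕ → List Symbol) : (k : Option (Fin N)) → List (Alphabet N k)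
  | none => []
  | some i => S i

lemma toStacks_update {S : ℕ → List Symbol} {k : ℕ} (hk : k < N) (l : List Symbol) :
    toStacks N (Function.update S k l) =
      Function.update (toStacks N S) (some (Fin.ofNat N k)) l := by
  funext i
  rcases i with _ | i
  · simp [toStacks]
  · by_cases h : i = Fin.ofNat N k
    · subst h
      simp [toStacks, Nat.mod_eq_of_lt hk]
    · have h' : (i : ℕ) ≠ k := by
        rintro rfl
        exact h (by simp)
      have h'' : (some i : Option (Fin N)) ≠ some (Fin.ofNat N k) := by simpa using h
      rw [Function.update_of_ne h'']
      simp [toStacks, h']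

lemma toStacks_apply {S : ℕ → List Symbol} {k : ℕ} (hk : k < N) :
    toStacks N S (some (Fin.ofNat N k)) = S k := by
  simp [toStacks, Nat.mod_eq_of_lt hk]

/-- A machine that contains the statements of `p` simulates every run of `p`, one step for each
test of a loop condition. -/
theorem Exec.simulate {p : StackProg} {S S' : ℕ → List Symbol} {t : ℕ} (h : p.Exec S S' t)
    (hN : p.Bounded N) (M : Λ → Turing.TM2.Stmt (Alphabet N) Λ Bool) (e : p.Loop → Λ)
    (c : Turing.TM2.Stmt (Alphabet N) Λ Bool) (hM : ∀ l, M (e l) = p.table e c l) (v : Bool) :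
    ∃ v', (flip bind (Turing.TM2.step M))^[t]
        (some (Turing.TM2.stepAux (p.code e c) v (toStacks N S))) =
      some (Turing.TM2.stepAux c v' (toStacks N S')) := by
  induction h generalizing c v with
  | skip => exact ⟨v, rfl⟩
  | push k s S =>
    refine ⟨v, ?_⟩
    have hk : k < N := hN
    simp only [Function.iterate_zero, id, code, Turing.TM2.stepAux, toStacks_update hk,
      toStacks_apply hk]
  | @seq p q S S' S'' t t' hp hq ihp ihq =>
    obtain ⟨v', h1⟩ := ihp hN.1 (fun l => e (.inl l)) (q.code (fun l => e (.inr l)) c)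
      (fun l => hM (.inl l)) v
    obtain ⟨v'', h2⟩ := ihq hN.2 (fun l => e (.inr l)) c (fun l => hM (.inr l)) v'
    refine ⟨v'', ?_⟩
    rw [Nat.add_comm, Function.iterate_add_apply]
    change _ = _ at h1
    rw [show code (StackProg.seq p q) e c =
      p.code (fun l => e (.inl l)) (q.code (fun l => e (.inr l)) c) from rfl, h1, h2]
  | @while_nil k p S h =>
    refine ⟨false, ?_⟩
    have hk : k < N := hN.1
    have h0 := hM none
    have hu : Function.update (toStacks N S) (some (Fin.ofNat N k)) [] = toStacks N S := by
      rw [← toStacks_update hk, ← h, Function.update_eq_self]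
    simp only [Function.iterate_one, code, Turing.TM2.stepAux, flip, Option.bind_eq_bind,
      Option.bind_some, Turing.TM2.step, h0, table, toStacks_apply hk, h]
    simp only [List.head?_nil, Option.isSome_none, id, cond_false, List.tail_nil, hu]
  | @while_cons k p S S' S'' t t' a l h hp hw ihp ihw =>
    have hk : k < N := hN.1
    have h0 := hM none
    obtain ⟨v', h1⟩ := ihp hN.2 (fun l => e (some l)) (.goto fun _ => e none)
      (fun l => hM (some l)) true
    obtain ⟨v'', h2⟩ := ihw hN e c hM v'
    refine ⟨v'', ?_⟩
    have e1 : flip bind (Turing.TM2.step M)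
        (some (Turing.TM2.stepAux (code (whilePop k p) e c) v (toStacks N S))) =
        some (Turing.TM2.stepAux (p.code (fun l => e (some l)) (.goto fun _ => e none)) true
          (toStacks N (Function.update S k l))) := by
      simp only [code, Turing.TM2.stepAux, flip, Option.bind_eq_bind,
        Option.bind_some, Turing.TM2.step, h0, table, toStacks_apply hk, h, toStacks_update hk]
      simp
    rw [Function.iterate_succ_apply, e1, Nat.add_comm, Function.iterate_add_apply, h1]
    exact h2

end StackProg

/-! ### Generators of strings -/

/-- Expressions for strings that depend on `n` natural numbers: single symbols, concatenation, a
variable in unary, and `loop e g`, the concatenation of the values of `g` where the new variable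
runs through the numbers below the length of the value of `e`. -/
inductive Gen : ℕ → Type
  | nil {n} : Gen n
  | emit {n} (s : Symbol) : Gen n
  | seq {n} (g h : Gen n) : Gen n
  | var {n} (i : Fin n) : Gen n
  | loop {n} (e : Gen n) (g : Gen (n + 1)) : Gen n

namespace Gen

/-- The string that a generator describes. -/
def eval : {n : ℕ} → Gen n → (Fin n → ℕ) → List Symbol
  | _, nil, _ => []
  | _, emit s, _ => [s]
  | _, seq g h, ρ => g.eval ρ ++ h.eval ρ
  | _, var i, ρ => ticks (ρ i)
  | _, loop e g, ρ => (List.range (e.eval ρ).length).flatMap fun j => g.eval (Fin.snoc ρ j)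

/-- The stack program of a generator. It pushes the string, with `μ` applied to every symbol, onto
the stack `tgt`, last symbol first; the variables are in unary on the stacks `τ i`, and the stack
`1` and the stacks from `m` on are free. Loops run downwards, since strings are pushed from their
end; so one stack can be both the loop counter and the loop variable. -/
def compile : {n : ℕ} → Gen n → (Symbol → Symbol) → (Fin n → ℕ) → ℕ → ℕ → StackProg
  | _, nil, _, _, _, _ => .skip
  | _, emit s, μ, _, tgt, _ => .push tgt (μ s)
  | _, seq g h, μ, τ, tgt, m => .seq (h.compile μ τ tgt m) (g.compile μ τ tgt m)
  | _, var i, μ, τ, tgt, _ =>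
      .seq (.whilePop (τ i) (.push 1 .tick))
        (.whilePop 1 (.seq (.push (τ i) .tick) (.push tgt (μ .tick))))
  | _, loop e g, μ, τ, tgt, m =>
      .seq (e.compile (fun _ => .tick) τ m (m + 1))
        (.whilePop m (g.compile μ (Fin.snoc τ m) tgt (m + 1)))

/-- A bound for the length of the string when all variables are at most the argument. -/
noncomputable def lengthBound : {n : ℕ} → Gen n → Polynomial ℕ
  | _, nil => 0
  | _, emit _ => 1
  | _, seq g h => g.lengthBound + h.lengthBound
  | _, var _ => Polynomial.X
  | _, loop e g => e.lengthBound * g.lengthBound.comp (Polynomial.X + e.lengthBound)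

/-- A bound for the running time of the stack program when all variables are at most the
argument. -/
noncomputable def timeBound : {n : ℕ} → Gen n → Polynomial ℕ
  | _, nil => 0
  | _, emit _ => 0
  | _, seq g h => g.timeBound + h.timeBound
  | _, var _ => 2 * Polynomial.X + 2
  | _, loop e g =>
      e.timeBound + (e.lengthBound * (g.timeBound.comp (Polynomial.X + e.lengthBound) + 1) + 1)

/-- The number of stacks that the program needs beyond the given ones. -/
def depth : {n : ℕ} → Gen n → ℕ
  | _, nil => 0
  | _, emit _ => 0
  | _, seq g h => max g.depth h.depth
  | _, var _ => 0
  | _, loop e g => max e.depth g.depth + 1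

lemma snoc_le {n N L : ℕ} {ρ : Fin n → ℕ} (hρ : ∀ i, ρ i ≤ N) {j : ℕ} (hj : j < L) {M : ℕ}
    (hL : L ≤ M) (i : Fin (n + 1)) : (Fin.snoc ρ j : Fin (n + 1) → ℕ) i ≤ N + M := by
  induction i using Fin.lastCases with
  | last => simp; omega
  | cast i => simp only [Fin.snoc_castSucc]; have := hρ i; omega

lemma length_eval_le {n : ℕ} (g : Gen n) {ρ : Fin n → ℕ} {N : ℕ} (hρ : ∀ i, ρ i ≤ N) :
    (g.eval ρ).length ≤ g.lengthBound.eval N := by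
  induction g generalizing N with
  | nil => simp [eval, lengthBound]
  | emit s => simp [eval, lengthBound]
  | seq g h ihg ihh =>
    simp only [eval, lengthBound, List.length_append, Polynomial.eval_add]
    exact add_le_add (ihg hρ) (ihh hρ)
  | var i => simpa [eval, lengthBound, ticks] using hρ i
  | loop e g ihe ihg =>
    simp only [eval, lengthBound, Polynomial.eval_mul, Polynomial.eval_comp,
      Polynomial.eval_add, Polynomial.eval_X, List.length_flatMap]
    refine (List.sum_le_card_nsmul _ (g.lengthBound.eval (N + e.lengthBound.eval N)) ?_).trans ?_
    · intro x hx
      obtain ⟨j, hj, rfl⟩ := List.mem_map.1 hx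
      exact ihg (snoc_le hρ (List.mem_range.1 hj) (ihe hρ))
    · simp only [List.length_map, List.length_range, smul_eq_mul]
      exact Nat.mul_le_mul_right _ (ihe hρ)

lemma bounded_compile {n : ℕ} (g : Gen n) (μ : Symbol → Symbol) {τ : Fin n → ℕ} {tgt m N : ℕ}
    (hτ : ∀ i, τ i < m) (ht : tgt < m) (hm : 1 < m) (hN : m + g.depth ≤ N) :
    (g.compile μ τ tgt m).Bounded N := by
  induction g generalizing μ tgt m with
  | nil => trivial
  | emit s => simp only [compile, StackProg.Bounded, depth] at *; omega
  | seq g h ihg ihh =>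
    simp only [depth] at hN
    exact ⟨ihh μ hτ ht hm (by omega), ihg μ hτ ht hm (by omega)⟩
  | var i =>
    have := hτ i
    simp only [compile, StackProg.Bounded, depth] at *
    omega
  | loop e g ihe ihg =>
    simp only [depth] at hN
    refine ⟨ihe _ (fun i => (hτ i).trans m.lt_succ_self) m.lt_succ_self (by omega) (by omega),
      by omega, ihg μ (fun i => ?_) (by omega) (by omega) (by omega)⟩
    induction i using Fin.lastCases with
    | last => simp
    | cast i => simp only [Fin.snoc_castSucc]; have := hτ i; omega

/-- Moving the number on stack `x` to stack `y`. -/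
lemma exec_unload {x y : ℕ} (h : x ≠ y) (a : ℕ) (S : ℕ → List Symbol) (hx : S x = ticks a) :
    (StackProg.whilePop x (.push y .tick)).Exec S
      (Function.update (Function.update S x []) y (ticks a ++ S y)) (a + 1) := by
  induction a generalizing S with
  | zero =>
    have : Function.update (Function.update S x []) y (ticks 0 ++ S y) = S := by
      funext i
      by_cases h1 : i = y
      · simp [h1, ticks]
      · by_cases h2 : i = x
        · subst h2; simpa [h1, ticks] using hx.symm
        · simp [h1, h2]
    rw [this]
    exact .while_nil hx
  | succ a ih =>
    have key := StackProg.Exec.while_cons (S := S) (k := x) (p := .push y .tick) (a := .tick)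
      (l := ticks a) (by rw [hx]; rfl) (.push y .tick _)
      (ih _ (by simp [h]))
    convert key using 1
    · funext i
      by_cases h1 : i = y
      · subst h1
        have : i ≠ x := h.symm
        simp only [Function.update_self, ne_eq, this, not_false_eq_true, Function.update_of_ne]
        simp only [ticks, List.replicate_succ', List.append_assoc]
        rfl
      · by_cases h2 : i = x
        · subst h2; simp [h1]
        · simp [h1, h2]
    · omega

/-- Moving the number on stack `1` back to stack `x`, with a copy of it onto stack `tgt`. -/
lemma exec_restore {x tgt : ℕ} (hx1 : x ≠ 1) (ht1 : tgt ≠ 1) (hxt : x ≠ tgt) (s : Symbol) (a : ℕ)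
    (S : ℕ → List Symbol) (h1 : S 1 = ticks a) :
    (StackProg.whilePop 1 (.seq (.push x .tick) (.push tgt s))).Exec S
      (Function.update (Function.update (Function.update S 1 []) x (ticks a ++ S x)) tgt
        (List.replicate a s ++ S tgt)) (a + 1) := by
  induction a generalizing S with
  | zero =>
    have : Function.update (Function.update (Function.update S 1 []) x (ticks 0 ++ S x)) tgt
        (List.replicate 0 s ++ S tgt) = S := by
      funext i
      by_cases h3 : i = tgt
      · simp [h3]
      · by_cases h4 : i = x
        · simp [h4, hxt, ticks]
        · by_cases h5 : i = 1
          · subst h5; simpa [h3, h4, ticks] using h1.symm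
          · simp [h3, h4, h5]
    rw [this]
    exact .while_nil h1
  | succ a ih =>
    have key := StackProg.Exec.while_cons (S := S) (k := 1)
      (p := .seq (.push x .tick) (.push tgt s)) (a := .tick)
      (l := ticks a) (by rw [h1]; rfl) (.seq (.push x .tick _) (.push tgt s _))
      (ih _ (by simp [hx1.symm, ht1.symm]))
    convert key using 1
    · funext i
      by_cases h3 : i = tgt
      · subst h3
        simp only [Function.update_self, ne_eq, hxt.symm, ht1, not_false_eq_true,
          Function.update_of_ne, List.replicate_succ', List.append_assoc]
        rfl
      · by_cases h4 : i = x
        · subst h4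
          simp only [Function.update_self, ne_eq, hxt, hx1, not_false_eq_true,
            Function.update_of_ne, ticks, List.replicate_succ', List.append_assoc]
          rfl
        · by_cases h5 : i = 1
          · subst h5; simp [h3, h4]
          · simp [h3, h4, h5]
    · omega

/-- The stack program of a generator does what it should, in polynomial time. -/
theorem exec_compile {n : ℕ} (g : Gen n) {μ : Symbol → Symbol} (hμ : μ .tick = .tick)
    {τ : Fin n → ℕ} {tgt m : ℕ} {S : ℕ → List Symbol} {ρ : Fin n → ℕ} {N : ℕ}
    (hρ : ∀ i, ρ i ≤ N) (hS : ∀ i, S (τ i) = ticks (ρ i)) (hτ : ∀ i, τ i < m)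
    (hτ1 : ∀ i, τ i ≠ 1) (hτt : ∀ i, τ i ≠ tgt) (ht : tgt < m) (ht1 : tgt ≠ 1) (hm : 1 < m)
    (hS1 : S 1 = []) (hfree : ∀ x, m ≤ x → S x = []) :
    ∃ t ≤ g.timeBound.eval N, (g.compile μ τ tgt m).Exec S
      (Function.update S tgt ((g.eval ρ).map μ ++ S tgt)) t := by
  induction g generalizing μ tgt m S N with
  | nil => exact ⟨0, by simp, by simpa [eval, compile] using StackProg.Exec.skip S⟩
  | emit s => exact ⟨0, by simp, by simpa [eval, compile] using StackProg.Exec.push tgt (μ s) S⟩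
  | seq g h ihg ihh =>
    obtain ⟨t, ht', e1⟩ := ihh hμ hρ hS hτ hτ1 hτt ht ht1 hm hS1 hfree
    obtain ⟨t', ht'', e2⟩ := ihg (S := Function.update S tgt ((h.eval ρ).map μ ++ S tgt)) hμ hρ
      (fun i => by simp [hτt i, hS]) hτ hτ1 hτt ht ht1 hm (by simp [ht1.symm, hS1])
      (fun x hx => by have : x ≠ tgt := by omega
                      simp [this, hfree x hx])
    refine ⟨t + t', ?_, ?_⟩
    · simp only [timeBound, Polynomial.eval_add]; omega
    · simpa [eval, compile] using StackProg.Exec.seq e1 e2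
  | var i =>
    have e1 := exec_unload (hτ1 i) (ρ i) S (hS i)
    have e2 := exec_restore (hτ1 i) ht1 (hτt i) (μ .tick) (ρ i) _
      (show Function.update (Function.update S (τ i) []) 1 (ticks (ρ i) ++ S 1) 1 = ticks (ρ i) by
        simp [hS1])
    refine ⟨(ρ i + 1) + (ρ i + 1), ?_, ?_⟩
    rotate_left
    · change (StackProg.seq _ _).Exec _ _ _
      convert StackProg.Exec.seq e1 e2 using 1
      funext x
      by_cases h3 : x = tgt
      · subst h3
        simp [(hτt i).symm, ht1, eval, ticks]
      · by_cases h4 : x = τ i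
        · subst h4
          simp [hτt i, hτ1 i, hS]
        · by_cases h5 : x = 1
          · subst h5; simp [h3, h4, hS1]
          · simp [h3, h4, h5]
    · have := hρ i
      simp only [timeBound, Polynomial.eval_add, Polynomial.eval_mul, Polynomial.eval_X,
        Polynomial.eval_ofNat]
      omega
  | loop e g ihe ihg =>
    obtain ⟨t, ht', e1⟩ := ihe (μ := fun _ => .tick) (tgt := m) (m := m + 1) rfl hρ hS
      (fun i => (hτ i).trans m.lt_succ_self) hτ1 (fun i => (hτ i).ne) m.lt_succ_self (by omega)
      (by omega) hS1 (fun x hx => hfree x (by omega))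
    have hlen := e.length_eval_le hρ
    set L := (e.eval ρ).length with hL
    have hmt : m ≠ tgt := by omega
    -- the loop from counter value `j` down to `0` writes the strings of the smaller values
    have loopExec : ∀ j ≤ L, ∀ S : ℕ → List Symbol, (∀ i, S (τ i) = ticks (ρ i)) → S 1 = [] →
        (∀ x, m ≤ x → S x = []) → ∃ t' ≤ j * (g.timeBound.eval (N + e.lengthBound.eval N) + 1) + 1,
        (StackProg.whilePop m (g.compile μ (Fin.snoc τ m) tgt (m + 1))).Exec
          (Function.update S m (ticks j))
          (Function.update S tgt
            (((List.range j).flatMap fun j => g.eval (Fin.snoc ρ j)).map μ ++ S tgt)) t' := by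
      intro j
      induction j with
      | zero =>
        intro _ S hS hS1 hfree
        refine ⟨1, by simp, ?_⟩
        have h1 : Function.update S m (ticks 0) = S := by
          rw [show ticks 0 = S m by rw [hfree m le_rfl]; rfl, Function.update_eq_self]
        rw [h1]
        simpa using StackProg.Exec.while_nil (hfree m le_rfl)
      | succ j ih =>
        intro hj S hS hS1 hfree
        obtain ⟨t1, ht1', e1⟩ := ihg (μ := μ) (tgt := tgt) (m := m + 1) (τ := Fin.snoc τ m)
          (ρ := Fin.snoc ρ j) (S := Function.update S m (ticks j)) (N := N + e.lengthBound.eval N)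
          hμ (snoc_le hρ (Nat.lt_of_succ_le hj) hlen)
          (fun i => by
            induction i using Fin.lastCases with
            | last => simp
            | cast i => simp [(hτ i).ne, hS])
          (fun i => by
            induction i using Fin.lastCases with
            | last => simp
            | cast i => simp only [Fin.snoc_castSucc]; have := hτ i; omega)
          (fun i => by
            induction i using Fin.lastCases with
            | last => simp; omega
            | cast i => simp only [Fin.snoc_castSucc]; exact hτ1 i)
          (fun i => by
            induction i using Fin.lastCases with
            | last => simpa using hmt
            | cast i => simp only [Fin.snoc_castSucc]; exact hτt i)
          (by omega) ht1 (by omega)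
          (by rw [Function.update_of_ne (by omega)]; exact hS1)
          (fun x hx => by rw [Function.update_of_ne (by omega)]; exact hfree x (by omega))
        obtain ⟨t2, ht2', e2⟩ := ih (by omega)
          (Function.update S tgt ((g.eval (Fin.snoc ρ j)).map μ ++ S tgt))
          (fun i => by simp [hτt i, hS]) (by simp [ht1.symm, hS1])
          (fun x hx => by
            rw [Function.update_of_ne (by omega)]; exact hfree x hx)
        refine ⟨t1 + t2 + 1, ?_, ?_⟩
        · have : (j + 1) * (g.timeBound.eval (N + e.lengthBound.eval N) + 1) =
            j * (g.timeBound.eval (N + e.lengthBound.eval N) + 1) +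
            (g.timeBound.eval (N + e.lengthBound.eval N) + 1) := by ring
          omega
        · have key := StackProg.Exec.while_cons (S := Function.update S m (ticks (j + 1))) (k := m)
            (p := g.compile μ (Fin.snoc τ m) tgt (m + 1)) (a := .tick) (l := ticks j) (t := t1)
            (t' := t2)
            (S' := Function.update (Function.update S tgt ((g.eval (Fin.snoc ρ j)).map μ ++ S tgt))
              m (ticks j))
            (by simp [ticks, List.replicate_succ]) (by
              rw [Function.update_idem, Function.update_comm hmt.symm]
              simpa [hmt.symm] using e1) e2
          simpa [List.range_succ, List.flatMap_append] using key
    obtain ⟨t', ht'', e2⟩ := loopExec L le_rfl S hS hS1 hfree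
    refine ⟨t + t', ?_, ?_⟩
    · simp only [timeBound, Polynomial.eval_add, Polynomial.eval_mul, Polynomial.eval_comp,
        Polynomial.eval_X, Polynomial.eval_one]
      have := Nat.mul_le_mul_right (g.timeBound.eval (N + e.lengthBound.eval N) + 1) hlen
      omega
    · have h3 : (e.eval ρ).map (fun _ => Symbol.tick) ++ S m = ticks L := by
        rw [hfree m le_rfl, List.append_nil]
        simp [ticks, hL]
      rw [h3] at e1
      exact StackProg.Exec.seq e1 e2

end Gen

/-- The machine that moves its input to stack `0` and then runs `p`; its output is stack `2`. -/
def StackProg.machine (p : StackProg) (N : ℕ) [NeZero N] : Turing.FinTM2 where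
  K := Option (Fin N)
  k₀ := none
  k₁ := some (Fin.ofNat N 2)
  Γ := StackProg.Alphabet N
  Λ := Option p.Loop
  main := none
  σ := Bool
  initialState := false
  Γk₀Fin := inferInstanceAs (Fintype Bool)
  m
    | none => .pop none (fun _ o => o.isSome)
        (.branch id (.push (some (Fin.ofNat N 0)) (fun _ => .tick) (.goto fun _ => none))
          (p.code some (.load (fun _ => false) .halt)))
    | some l => p.table some (.load (fun _ => false) .halt) l

/-- The stacks of the machine while the input is read. -/
def StackProg.readStacks (N : ℕ) [NeZero N] (l : List Bool) (a : ℕ) :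
    (k : Option (Fin N)) → List (StackProg.Alphabet N k)
  | none => l
  | some i => if i = Fin.ofNat N 0 then ticks a else []

open StackProg in
lemma StackProg.machine_read (p : StackProg) (N : ℕ) [NeZero N] (l : List Bool) (a : ℕ) (v : Bool) :
    (flip bind (p.machine N).step)^[l.length + 1]
      (some ⟨some none, v, readStacks N l a⟩) =
    some (Turing.TM2.stepAux (p.code some (.load (fun _ => false) .halt)) false
      (readStacks N [] (l.length + a))) := by
  induction l generalizing a v with
  | nil =>
    have : Function.update (readStacks N [] a) none [] = readStacks N [] a :=
      Function.update_eq_self (f := readStacks N [] a) none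
    change some (Turing.TM2.stepAux _ _ (Function.update (readStacks N [] a) none [])) = _
    rw [this, List.length_nil, zero_add]
    rfl
  | cons b l ih =>
    rw [List.length_cons, Function.iterate_succ_apply]
    have : flip bind (p.machine N).step (some ⟨some none, v, readStacks N (b :: l) a⟩) =
        some ⟨some none, true, readStacks N l (a + 1)⟩ := by
      have h : Function.update (Function.update (readStacks N (b :: l) a) none l)
          (some (Fin.ofNat N 0)) (.tick :: ticks a) = readStacks N l (a + 1) := by
        funext i
        rcases i with _ | i
        · simp [readStacks]
        · by_cases hi : i = Fin.ofNat N 0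
          · subst hi; simp [readStacks, ticks, List.replicate_succ]
          · have : (some i : Option (Fin N)) ≠ some (Fin.ofNat N 0) := by simpa using hi
            rw [Function.update_of_ne this, Function.update_of_ne (by simp)]
            simp only [readStacks, hi, if_false]
      rw [← h]
      rfl
    rw [this, ih, show l.length + (a + 1) = l.length + 1 + a by ring]

/-- `f` is the value of a generator: such strings can be written down by a polynomial-time
machine. -/
def Writable {n : ℕ} (f : (Fin n → ℕ) → List Symbol) : Prop := ∃ g : Gen n, ∀ ρ, g.eval ρ = f ρ

lemma length_unaryEncodeNat (n : ℕ) : (Computability.unaryEncodeNat n).length = n :=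
  Computability.unary_decode_encode_nat n

open StackProg in
/-- The machine of the stack program of a generator writes down the value of the generator in
polynomial time. The program is followed by a loop that clears the input counter, because a halted
machine has to leave all stacks but the output empty. -/
theorem Writable.computable {α : Type} {enc : α → List Symbol} {F : ℕ → α}
    (h : Writable fun ρ : Fin 1 → ℕ => enc (F (ρ 0))) :
    Nonempty (Turing.TM2ComputableInPolyTime Computability.unaryEncodeNat enc F) := by
  obtain ⟨g, hg⟩ := h
  let p : StackProg := .seq (g.compile id (fun _ => 0) 2 3) (.whilePop 0 .skip)
  let N := 3 + g.depth
  have : NeZero N := ⟨by omega⟩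
  have hN : p.Bounded N := ⟨g.bounded_compile id (by simp) (by simp) (by simp) le_rfl,
    by omega, trivial⟩
  have run : ∀ ℓ, ∃ t ≤ (g.timeBound.eval ℓ + (ℓ + 1)), p.Exec
      (fun k => if k = 0 then ticks ℓ else []) (fun k => if k = 2 then enc (F ℓ) else []) t := by
    intro ℓ
    obtain ⟨t, ht, e⟩ := g.exec_compile (μ := id) rfl (τ := fun _ => 0) (tgt := 2) (m := 3)
      (S := fun k => if k = 0 then ticks ℓ else []) (ρ := fun _ => ℓ) (N := ℓ) (by simp) (by simp)
      (by simp) (by simp) (by simp) (by simp) (by simp) (by simp) (by simp)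
      (fun x hx => by have : x ≠ 0 := by omega
                      simp [this])
    have clear : ∀ (a : ℕ) (S : ℕ → List Symbol), S 0 = ticks a →
        (whilePop 0 .skip).Exec S (Function.update S 0 []) (a + 1) := by
      intro a
      induction a with
      | zero =>
        intro S hS
        rw [show Function.update S 0 [] = S from by
          rw [show ([] : List Symbol) = S 0 from hS.symm, Function.update_eq_self]]
        exact .while_nil hS
      | succ a ih =>
        intro S hS
        have := Exec.while_cons (k := 0) (p := .skip) (S := S) (a := .tick) (l := ticks a)
          (by rw [hS]; rfl) (.skip _) (ih _ (by simp))
        simpa [Nat.add_comm] using this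
    refine ⟨t + (ℓ + 1), by omega, ?_⟩
    convert Exec.seq e (clear ℓ _ (by simp)) using 1
    funext k
    rcases eq_or_ne k 0 with rfl | h0
    · simp
    · rcases eq_or_ne k 2 with rfl | h2
      · simp [hg]
      · simp [h0, h2]
  refine ⟨⟨⟨p.machine N, Equiv.refl Bool, Equiv.refl Symbol⟩,
    g.timeBound + (Polynomial.X + 1) + (Polynomial.X + 1), fun ℓ => ⟨⟨?_, ?_⟩, ?_⟩⟩⟩
  · exact (run ℓ).choose + (ℓ + 1)
  · obtain ⟨ht, e⟩ := (run ℓ).choose_spec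
    obtain ⟨v', hv⟩ := e.simulate (N := N) hN (p.machine N).m some (.load (fun _ => false) .halt)
      (fun l => rfl) false
    have h1 := p.machine_read N (Computability.unaryEncodeNat ℓ) 0 false
    rw [Function.iterate_add_apply]
    rw [length_unaryEncodeNat] at h1
    have hinit : Turing.initList (p.machine N) (List.map (Equiv.refl Bool).invFun
        (Computability.unaryEncodeNat ℓ)) =
        ⟨some none, false, readStacks N (Computability.unaryEncodeNat ℓ) 0⟩ := by
      simp only [Turing.initList]
      congr 1
      funext k
      rcases k with _ | i
      · simp [machine, readStacks]
        rfl
      · simp [machine, readStacks, ticks]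
    have hst : readStacks N [] (ℓ + 0) = toStacks N fun k => if k = 0 then ticks ℓ else [] := by
      funext k
      rcases k with _ | i
      · rfl
      · simp only [readStacks, toStacks, add_zero]
        by_cases hi : i = Fin.ofNat N 0
        · subst hi; simp
        · have : (i : ℕ) ≠ 0 := fun h => hi (Fin.ext (by simpa using h))
          rw [if_neg hi, if_neg this]
    have hfin : Turing.haltList (p.machine N) (List.map (Equiv.refl Symbol).invFun (enc (F ℓ))) =
        ⟨none, false, toStacks N fun k => if k = 2 then enc (F ℓ) else []⟩ := by
      simp only [Turing.haltList]
      congr 1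
      funext k
      rcases k with _ | i
      · simp [machine, toStacks]
      · by_cases hi : i = Fin.ofNat N 2
        · subst hi
          have : 2 % N = 2 := Nat.mod_eq_of_lt (by omega)
          simp [machine, toStacks, this]
          rfl
        · have : (i : ℕ) ≠ 2 := fun h => hi (Fin.ext (by
            simpa [Nat.mod_eq_of_lt (show 2 < N by omega)] using h))
          have hi' : (some i : Option (Fin N)) ≠ some (Fin.ofNat N 2) := by simpa using hi
          rw [show toStacks N (fun k => if k = 2 then enc (F ℓ) else []) (some i) = [] from
            if_neg this]
          exact dif_neg hi'
    rw [hst] at h1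
    erw [hinit, h1]
    erw [hv]
    exact congrArg some hfin.symm
  · have := (run ℓ).choose_spec.1
    simp only [length_unaryEncodeNat, Polynomial.eval_add, Polynomial.eval_X, Polynomial.eval_one]
    omega

/-! ### Strings that are written by generators -/

namespace Writable

variable {n : ℕ}

lemma congr {f g : (Fin n → ℕ) → List Symbol} (hf : Writable f) (h : ∀ ρ, f ρ = g ρ) :
    Writable g := by
  obtain ⟨G, hG⟩ := hf
  exact ⟨G, fun ρ => (hG ρ).trans (h ρ)⟩

lemma nil : Writable fun _ : Fin n → ℕ => [] := ⟨.nil, fun _ => rfl⟩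

lemma singleton (s : Symbol) : Writable fun _ : Fin n → ℕ => [s] := ⟨.emit s, fun _ => rfl⟩

lemma append {f g : (Fin n → ℕ) → List Symbol} (hf : Writable f) (hg : Writable g) :
    Writable fun ρ => f ρ ++ g ρ := by
  obtain ⟨F, hF⟩ := hf
  obtain ⟨G, hG⟩ := hg
  exact ⟨.seq F G, fun ρ => by simp [Gen.eval, hF, hG]⟩

lemma cons (s : Symbol) {f : (Fin n → ℕ) → List Symbol} (hf : Writable f) :
    Writable fun ρ => s :: f ρ :=
  (singleton s).append hf

end Writable

/-- The number `e` can be computed by a generator, in unary. -/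
def Expressible {n : ℕ} (e : (Fin n → ℕ) → ℕ) : Prop := Writable fun ρ => ticks (e ρ)

lemma Writable.flatMap_range {n : ℕ} {e : (Fin n → ℕ) → ℕ} {f : (Fin n → ℕ) → ℕ → List Symbol}
    (he : Expressible e)
    (hf : Writable fun ρ : Fin (n + 1) → ℕ => f (Fin.init ρ) (ρ (Fin.last n))) :
    Writable fun ρ => (List.range (e ρ)).flatMap (f ρ) := by
  obtain ⟨E, hE⟩ := he
  obtain ⟨F, hF⟩ := hf
  exact ⟨.loop E F, fun ρ => by simp [Gen.eval, hE, hF, ticks]⟩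

/-- Adds an unused variable to a generator. The new variable is the one numbered `k`. -/
def Gen.weaken : {n : ℕ} → (k : ℕ) → Gen n → Gen (n + 1)
  | _, _, .nil => .nil
  | _, _, .emit s => .emit s
  | _, k, .seq g h => .seq (g.weaken k) (h.weaken k)
  | _, k, .var i => .var (if (i : ℕ) < k then i.castSucc else i.succ)
  | _, k, .loop e g => .loop (e.weaken k) (g.weaken k)

lemma Gen.eval_weaken {n : ℕ} (g : Gen n) (k : ℕ) (hk : k ≤ n) (ρ : Fin (n + 1) → ℕ) :
    (g.weaken k).eval ρ =
      g.eval fun i => ρ (if (i : ℕ) < k then i.castSucc else i.succ) := by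
  induction g with
  | nil => rfl
  | emit s => rfl
  | seq g h ihg ihh => simp [weaken, eval, ihg hk, ihh hk]
  | var i => simp [weaken, eval]
  | @loop n e g ihe ihg =>
    simp only [weaken, eval, ihe hk]
    congr 1
    funext j
    rw [ihg (by omega)]
    congr 1
    funext i
    induction i using Fin.lastCases with
    | last =>
      have : ¬ n < k := by omega
      simp only [Fin.val_last, this, if_false, Fin.succ_last, Fin.snoc_last]
    | cast i =>
      simp only [Fin.val_castSucc, Fin.snoc_castSucc]
      split_ifs
      · rw [Fin.snoc_castSucc]
      · rw [Fin.succ_castSucc, Fin.snoc_castSucc]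

namespace Expressible

variable {n : ℕ}

lemma proj (i : Fin n) : Expressible fun ρ => ρ i := ⟨.var i, fun _ => rfl⟩

lemma init {e : (Fin n → ℕ) → ℕ} (he : Expressible e) :
    Expressible fun ρ : Fin (n + 1) → ℕ => e (Fin.init ρ) := by
  obtain ⟨E, hE⟩ := he
  refine ⟨E.weaken n, fun ρ => ?_⟩
  rw [Gen.eval_weaken _ _ le_rfl, hE]
  congr 2
  funext i
  simp [Fin.init]

lemma const (c : ℕ) : Expressible fun _ : Fin n → ℕ => c := by
  induction c with
  | zero => exact Writable.nil
  | succ c ih => exact Writable.cons .tick ih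

lemma add {e f : (Fin n → ℕ) → ℕ} (he : Expressible e) (hf : Expressible f) :
    Expressible fun ρ => e ρ + f ρ :=
  (Writable.append he hf).congr fun ρ => by simp [ticks]

lemma mul {e f : (Fin n → ℕ) → ℕ} (he : Expressible e) (hf : Expressible f) :
    Expressible fun ρ => e ρ * f ρ :=
  (Writable.flatMap_range (f := fun ρ _ => ticks (f ρ)) he hf.init).congr fun ρ => by
    have key : ∀ a b : ℕ, ((List.range a).flatMap fun _ => ticks b) = ticks (a * b) := by
      intro a b
      induction a with
      | zero => simp [ticks]
      | succ a ih =>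
        rw [List.range_succ, List.flatMap_append, ih]
        simp [ticks, Nat.succ_mul]
    exact key _ _

lemma pow {e : (Fin n → ℕ) → ℕ} (he : Expressible e) (m : ℕ) : Expressible fun ρ => e ρ ^ m := by
  induction m with
  | zero => simpa using const 1
  | succ m ih => simpa [pow_succ] using ih.mul he

lemma polynomial_eval (P : Polynomial ℕ) {e : (Fin n → ℕ) → ℕ} (he : Expressible e) :
    Expressible fun ρ => P.eval (e ρ) := by
  induction P using Polynomial.induction_on' with
  | add p q hp hq => simpa using hp.add hq
  | monomial m a => simpa using (const a).mul (he.pow m)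

end Expressible

/-! ### Circuits with numbered qubits -/

/-- The unitary gates and postselection, for qubits that are given by arbitrary natural numbers. -/
inductive Op : Type
  | had (i : ℕ)
  | tof (a b t : ℕ)
  | post (i : ℕ)

namespace Op

/-- The operation makes sense on `n` qubits. -/
def Valid (n : ℕ) : Op → Prop
  | had i => i < n
  | tof a b t => (a < n ∧ b < n ∧ t < n) ∧ a ≠ b ∧ a ≠ t ∧ b ≠ t
  | post i => i < n

/-- The instruction on `n` qubits that an operation stands for. -/
def toGate (n : ℕ) : Op → Option (Gate n)
  | had i => if h : i < n then some (.hadamard ⟨i, h⟩) else none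
  | tof a b t =>
      if h : (a < n ∧ b < n ∧ t < n) ∧ a ≠ b ∧ a ≠ t ∧ b ≠ t then
        some (.toffoli ⟨a, h.1.1⟩ ⟨b, h.1.2.1⟩ ⟨t, h.1.2.2⟩ (by simpa using h.2.1)
          (by simpa using h.2.2.1) (by simpa using h.2.2.2))
      else none
  | post i => if h : i < n then some (.postselect ⟨i, h⟩) else none

/-- The description of an operation as a string. -/
def encode : Op → List Symbol
  | had i => Symbol.hadamard :: ticks i
  | tof a b t => Symbol.toffoli :: (ticks a ++ Symbol.sep :: (ticks b ++ Symbol.sep :: ticks t))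
  | post i => Symbol.postselect :: ticks i

end Op

/-- The instructions on `n` qubits that a list of operations stands for; operations that make no
sense are dropped. -/
def gatesOf (n : ℕ) (L : List Op) : List (Gate n) := L.filterMap (Op.toGate n)

/-- All operations of the list make sense on `n` qubits. -/
def AllValid (n : ℕ) (L : List Op) : Prop := ∀ o ∈ L, o.Valid n

lemma AllValid.append {n : ℕ} {L L' : List Op} (h : AllValid n L) (h' : AllValid n L') :
    AllValid n (L ++ L') := fun o ho => (List.mem_append.1 ho).elim (h o) (h' o)

lemma AllValid.cons {n : ℕ} {o : Op} {L : List Op} (h : o.Valid n) (h' : AllValid n L) :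
    AllValid n (o :: L) := by
  simpa [AllValid] using ⟨h, h'⟩

lemma AllValid.nil {n : ℕ} : AllValid n [] := by simp [AllValid]

lemma AllValid.flatMap {n : ℕ} {ι : Type} {l : List ι} {F : ι → List Op}
    (h : ∀ i ∈ l, AllValid n (F i)) : AllValid n (l.flatMap F) := by
  intro o ho
  obtain ⟨i, hi, ho⟩ := List.mem_flatMap.1 ho
  exact h i hi o ho

lemma encode_gatesOf {n : ℕ} {L : List Op} (h : AllValid n L) :
    (gatesOf n L).flatMap Gate.encode = L.flatMap Op.encode := by
  induction L with
  | nil => rfl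
  | cons o L ih =>
    have ho : ∃ g, o.toGate n = some g ∧ g.encode = o.encode := by
      have := h o (by simp)
      cases o with
      | had i => exact ⟨_, dif_pos this, rfl⟩
      | tof a b t => exact ⟨_, dif_pos this, rfl⟩
      | post i => exact ⟨_, dif_pos this, rfl⟩
    obtain ⟨g, hg, hg'⟩ := ho
    have ih' := ih fun o' ho' => h o' (by simp [ho'])
    simp only [gatesOf] at ih' ⊢
    rw [List.filterMap_cons_some hg, List.flatMap_cons, List.flatMap_cons, ih', hg']

/-- The description of the list of operations `f` is written by a generator. -/
def OpsWritable {n : ℕ} (f : (Fin n → ℕ) → List Op) : Prop :=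
  Writable fun ρ => (f ρ).flatMap Op.encode

namespace OpsWritable

variable {n : ℕ}

lemma nil : OpsWritable fun _ : Fin n → ℕ => [] := Writable.nil

lemma append {f g : (Fin n → ℕ) → List Op} (hf : OpsWritable f) (hg : OpsWritable g) :
    OpsWritable fun ρ => f ρ ++ g ρ :=
  (Writable.append hf hg).congr fun ρ => by simp

lemma had {i : (Fin n → ℕ) → ℕ} {f : (Fin n → ℕ) → List Op} (hi : Expressible i)
    (hf : OpsWritable f) : OpsWritable fun ρ => .had (i ρ) :: f ρ :=
  ((Writable.cons .hadamard hi).append hf).congr fun ρ => by simp [Op.encode]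

lemma post {i : (Fin n → ℕ) → ℕ} {f : (Fin n → ℕ) → List Op} (hi : Expressible i)
    (hf : OpsWritable f) : OpsWritable fun ρ => .post (i ρ) :: f ρ :=
  ((Writable.cons .postselect hi).append hf).congr fun ρ => by simp [Op.encode]

lemma tof {a b t : (Fin n → ℕ) → ℕ} {f : (Fin n → ℕ) → List Op} (ha : Expressible a)
    (hb : Expressible b) (ht : Expressible t) (hf : OpsWritable f) :
    OpsWritable fun ρ => .tof (a ρ) (b ρ) (t ρ) :: f ρ :=
  ((Writable.cons .toffoli (Writable.append ha (Writable.cons .sep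
    (Writable.append hb (Writable.cons .sep ht))))).append hf).congr fun ρ => by
      simp [Op.encode]

lemma flatMap_range {e : (Fin n → ℕ) → ℕ} {f : (Fin n → ℕ) → ℕ → List Op}
    (he : Expressible e)
    (hf : OpsWritable fun ρ : Fin (n + 1) → ℕ => f (Fin.init ρ) (ρ (Fin.last n))) :
    OpsWritable fun ρ => (List.range (e ρ)).flatMap (f ρ) :=
  (Writable.flatMap_range (f := fun ρ j => (f ρ j).flatMap Op.encode) he hf).congr fun ρ => by
    rw [List.flatMap_assoc]

end OpsWritable

/-! ### Product states and gates -/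

/-- The effect of an operation on (unnormalized) state vectors; an operation that makes no sense
does nothing. -/
noncomputable def Op.apply (n : ℕ) (o : Op) (φ : State n) : State n :=
  match o with
  | .had i => if h : i < n then applyHadamard ⟨i, h⟩ φ else φ
  | .tof a b t =>
      if h : (a < n ∧ b < n ∧ t < n) ∧ a ≠ b ∧ a ≠ t ∧ b ≠ t then
        applyToffoli ⟨a, h.1.1⟩ ⟨b, h.1.2.1⟩ ⟨t, h.1.2.2⟩ φ
      else φ
  | .post i => if h : i < n then project ⟨i, h⟩ true φ else φ

/-- The effect of a list of operations on (unnormalized) state vectors. -/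
noncomputable def run (n : ℕ) (L : List Op) (φ : State n) : State n :=
  L.foldl (fun φ o => o.apply n φ) φ

@[simp] lemma run_nil (n : ℕ) (φ : State n) : run n [] φ = φ := rfl

lemma run_cons (n : ℕ) (o : Op) (L : List Op) (φ : State n) :
    run n (o :: L) φ = run n L (o.apply n φ) := rfl

lemma run_append (n : ℕ) (L L' : List Op) (φ : State n) :
    run n (L ++ L') φ = run n L' (run n L φ) := List.foldl_append

lemma Op.apply_add (n : ℕ) (o : Op) (φ χ : State n) :
    o.apply n (φ + χ) = o.apply n φ + o.apply n χ := by
  cases o with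
  | had i =>
    simp only [apply]
    split_ifs
    · funext x
      simp only [applyHadamard, Pi.add_apply]
      ring
    · rfl
  | tof a b t => simp only [apply]; split_ifs <;> rfl
  | post i =>
    simp only [apply]
    split_ifs
    · funext x
      simp only [project, Pi.add_apply]
      split_ifs <;> simp
    · rfl

lemma Op.apply_smul (n : ℕ) (o : Op) (r : ℝ) (φ : State n) :
    o.apply n (r • φ) = r • o.apply n φ := by
  cases o with
  | had i =>
    simp only [apply]
    split_ifs
    · funext x
      simp only [applyHadamard, Pi.smul_apply, Complex.real_smul]
      ring
    · rfl
  | tof a b t => simp only [apply]; split_ifs <;> rfl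
  | post i =>
    simp only [apply]
    split_ifs
    · funext x
      simp only [project, Pi.smul_apply]
      split_ifs <;> simp
    · rfl

lemma run_add (n : ℕ) (L : List Op) (φ χ : State n) :
    run n L (φ + χ) = run n L φ + run n L χ := by
  induction L generalizing φ χ with
  | nil => rfl
  | cons o L ih => simp only [run_cons, Op.apply_add, ih]

lemma run_smul (n : ℕ) (L : List Op) (r : ℝ) (φ : State n) :
    run n L (r • φ) = r • run n L φ := by
  induction L generalizing φ with
  | nil => rfl
  | cons o L ih => simp only [run_cons, Op.apply_smul, ih]

lemma outcomeProb_gatesOf (n : ℕ) (L : List Op) (gs : List (Gate n)) (φ : State n)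
    (E : Set (Fin n → Bool)) :
    outcomeProb (gatesOf n L ++ gs) φ E = outcomeProb gs (run n L φ) E := by
  induction L generalizing φ with
  | nil => rfl
  | cons o L ih =>
    rw [run_cons, ← ih]
    simp only [gatesOf, List.filterMap_cons]
    cases o with
    | had i => by_cases h : i < n <;> simp [Op.toGate, Op.apply, h, outcomeProb]
    | tof a b t =>
      by_cases h : (a < n ∧ b < n ∧ t < n) ∧ a ≠ b ∧ a ≠ t ∧ b ≠ t
      · simp only [Op.toGate, Op.apply, dif_pos h, List.cons_append, outcomeProb]
      · simp only [Op.toGate, Op.apply, dif_neg h]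
    | post i => by_cases h : i < n <;> simp [Op.toGate, Op.apply, h, outcomeProb]

/-- The product state of `n` qubits in which qubit `i` has the vector `q i`. -/
noncomputable def pstate (n : ℕ) (q : ℕ → Qubit) : State n := productState fun i : Fin n => q i

lemma ket_apply (r b : Bool) : (ket r) (if b then 1 else 0) = if b = r then 1 else 0 := by
  cases r <;> cases b <;> simp [ket]

/-- The amplitude of `x` in `pstate n q`, without the factor that belongs to qubit `i`. -/
noncomputable def restAmp {n : ℕ} (q : ℕ → Qubit) (i : Fin n) (x : Fin n → Bool) : ℂ :=
  ∏ j ∈ Finset.univ.erase i, q j (if x j then 1 else 0)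

lemma pstate_update_apply {n : ℕ} (q : ℕ → Qubit) (i : Fin n) (v : Qubit) (x : Fin n → Bool) :
    pstate n (Function.update q i v) x = v (if x i then 1 else 0) * restAmp q i x := by
  rw [pstate, productState, ← Finset.mul_prod_erase _ _ (Finset.mem_univ i)]
  congr 1
  · simp
  · refine Finset.prod_congr rfl fun j hj => ?_
    have : (j : ℕ) ≠ i := fun h => Finset.ne_of_mem_erase hj (Fin.ext h)
    rw [Function.update_of_ne this]

lemma pstate_apply {n : ℕ} (q : ℕ → Qubit) (i : Fin n) (x : Fin n → Bool) :
    pstate n q x = q i (if x i then 1 else 0) * restAmp q i x := by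
  rw [← pstate_update_apply, Function.update_eq_self]

lemma restAmp_update {n : ℕ} (q : ℕ → Qubit) (i : Fin n) (x : Fin n → Bool) (b : Bool) :
    restAmp q i (Function.update x i b) = restAmp q i x := by
  refine Finset.prod_congr rfl fun j hj => ?_
  rw [Function.update_of_ne (Finset.ne_of_mem_erase hj)]

lemma pstate_update_add {n : ℕ} (q : ℕ → Qubit) {i : ℕ} (hi : i < n) (v w : Qubit) :
    pstate n (Function.update q i (v + w)) =
      pstate n (Function.update q i v) + pstate n (Function.update q i w) := by
  funext x
  have h := fun v => pstate_update_apply q ⟨i, hi⟩ v x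
  simp only [Pi.add_apply] at h ⊢
  rw [h, h, h, PiLp.add_apply, add_mul]

lemma pstate_update_smul {n : ℕ} (q : ℕ → Qubit) {i : ℕ} (hi : i < n) (r : ℝ) (v : Qubit) :
    pstate n (Function.update q i (r • v)) = r • pstate n (Function.update q i v) := by
  funext x
  have h := fun v => pstate_update_apply q ⟨i, hi⟩ v x
  simp only [Pi.smul_apply] at h ⊢
  rw [h, h, PiLp.smul_apply, smul_mul_assoc]

lemma pstate_tof {n : ℕ} {q : ℕ → Qubit} {a b t : ℕ} (ha : a < n) (hb : b < n) (ht : t < n)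
    (hab : a ≠ b) (hat : a ≠ t) (hbt : b ≠ t) {α β τ : Bool} (qa : q a = ket α) (qb : q b = ket β)
    (qt : q t = ket τ) :
    (Op.tof a b t).apply n (pstate n q) =
      pstate n (Function.update q t (ket (xor τ (α && β)))) := by
  have hv : (a < n ∧ b < n ∧ t < n) ∧ a ≠ b ∧ a ≠ t ∧ b ≠ t := ⟨⟨ha, hb, ht⟩, hab, hat, hbt⟩
  simp only [Op.apply, dif_pos hv]
  funext x
  have key : ∀ c : ℕ, ∀ hc : c < n, ∀ κ, q c = ket κ → c ≠ t → x ⟨c, hc⟩ ≠ κ →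
      restAmp q ⟨t, ht⟩ x = 0 := by
    intro c hc κ hq hct hx
    refine Finset.prod_eq_zero (i := ⟨c, hc⟩) (by simp [hct]) ?_
    simp only [hq, ket_apply, if_neg hx]
  have h1 := pstate_update_apply q ⟨t, ht⟩ (ket (xor τ (α && β))) x
  simp only at h1
  rw [h1, applyToffoli, pstate_apply q ⟨t, ht⟩, restAmp_update]
  by_cases xa : x ⟨a, ha⟩ = α
  · by_cases xb : x ⟨b, hb⟩ = β
    · congr 1
      simp only [Function.update_self, qt, ket_apply, xa, xb]
      cases x ⟨t, ht⟩ <;> cases τ <;> cases α <;> cases β <;> rfl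
    · rw [key b hb β qb hbt xb, mul_zero, mul_zero]
  · rw [key a ha α qa hat xa, mul_zero, mul_zero]

lemma pstate_post {n : ℕ} {q : ℕ → Qubit} {i : ℕ} (hi : i < n) {τ : Bool} (hq : q i = ket τ) :
    (Op.post i).apply n (pstate n q) = (if τ then 1 else 0 : ℝ) • pstate n q := by
  simp only [Op.apply, dif_pos hi]
  funext x
  rw [project, Pi.smul_apply, pstate_apply q ⟨i, hi⟩]
  simp only [hq, ket_apply]
  cases τ <;> cases x ⟨i, hi⟩ <;> simp

lemma pstate_had {n : ℕ} {q : ℕ → Qubit} {i : ℕ} (hi : i < n) {τ : Bool} (hq : q i = ket τ) :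
    (Op.had i).apply n (pstate n q) = (√2)⁻¹ •
      (pstate n (Function.update q i (ket false)) +
        (if τ then -1 else 1 : ℝ) • pstate n (Function.update q i (ket true))) := by
  simp only [Op.apply, dif_pos hi]
  funext x
  have h := fun v => pstate_update_apply q ⟨i, hi⟩ v x
  simp only at h
  simp only [applyHadamard, Pi.smul_apply, Pi.add_apply]
  rw [h, h, pstate_apply q ⟨i, hi⟩, pstate_apply q ⟨i, hi⟩, restAmp_update, restAmp_update]
  simp only [hq, Function.update_self, ket_apply, Complex.real_smul, Complex.ofReal_inv]
  cases τ <;> cases x ⟨i, hi⟩ <;> simp <;> ring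

lemma had_had (n : ℕ) {i : ℕ} (hi : i < n) (φ : State n) :
    (Op.had i).apply n ((Op.had i).apply n φ) = φ := by
  simp only [Op.apply, dif_pos hi]
  funext x
  have h2 : (√2 : ℂ) * (√2 : ℂ) = 2 := by
    rw [← Complex.ofReal_mul, Real.mul_self_sqrt (by norm_num)]; norm_num
  have h0 : (√2 : ℂ) ≠ 0 := by
    intro h; rw [h] at h2; norm_num at h2
  simp only [applyHadamard, Function.update_idem, Function.update_self]
  cases hx : x ⟨i, hi⟩
  · have : Function.update x ⟨i, hi⟩ false = x := by rw [← hx, Function.update_eq_self]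
    rw [this]
    field_simp
    simp
    linear_combination (-φ x) * h2
  · have : Function.update x ⟨i, hi⟩ true = x := by rw [← hx, Function.update_eq_self]
    rw [this]
    field_simp
    simp
    linear_combination (-φ x) * h2

/-! ### Gadgets that multiply amplitudes -/

lemma run_had_post {n : ℕ} {q : ℕ → Qubit} {i : ℕ} (hi : i < n) {τ : Bool} (hq : q i = ket τ) :
    run n [.had i, .post i] (pstate n q) =
      ((√2)⁻¹ * (if τ then -1 else 1 : ℝ)) • pstate n (Function.update q i (ket true)) := by
  rw [run_cons, pstate_had hi hq, run_smul, run_add, run_smul]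
  simp only [run_cons, run_nil]
  rw [pstate_post hi (τ := false) (by simp), pstate_post hi (τ := true) (by simp)]
  simp

/-- Removal of the branches in which qubits `x` and `c` are both `|1⟩`. -/
lemma run_kill {n : ℕ} {q : ℕ → Qubit} {x c f : ℕ} (hx : x < n) (hc : c < n) (hf : f < n)
    (hxc : x ≠ c) (hxf : x ≠ f) (hcf : c ≠ f) {ξ γ : Bool} (qx : q x = ket ξ) (qc : q c = ket γ)
    (qf : q f = ket true) :
    run n [.tof x c f, .post f] (pstate n q) = (if ξ && γ then 0 else 1 : ℝ) • pstate n q := by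
  rw [run_cons, pstate_tof hx hc hf hxc hxf hcf qx qc qf, run_cons,
    pstate_post hf (τ := xor true (ξ && γ)) (by simp), run_nil]
  cases h : ξ && γ
  · simp [← qf]
  · simp

/-- Removal of the branches in which qubit `x` is `|1⟩` and `c` is `|0⟩`; qubit `o` is `|1⟩`. -/
lemma run_kill_unless {n : ℕ} {q : ℕ → Qubit} {x c f o : ℕ} (hx : x < n) (hc : c < n) (hf : f < n)
    (ho : o < n) (hxc : x ≠ c) (hxf : x ≠ f) (hcf : c ≠ f) (hxo : x ≠ o) (hof : o ≠ f) {ξ γ : Bool}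
    (qx : q x = ket ξ) (qc : q c = ket γ) (qf : q f = ket true) (qo : q o = ket true) :
    run n [.tof x o f, .tof x c f, .post f] (pstate n q) =
      (if ξ && !γ then 0 else 1 : ℝ) • pstate n q := by
  rw [run_cons, pstate_tof hx ho hf hxo hxf hof qx qo qf, run_cons,
    pstate_tof hx hc hf hxc hxf hcf (α := ξ) (β := γ) (τ := xor true (ξ && true))
    (by simp [hxf, qx]) (by simp [hcf, qc]) (by simp), run_cons,
    pstate_post hf (τ := xor (xor true (ξ && true)) (ξ && γ)) (by simp), run_nil]
  cases ξ <;> cases γ <;> simp [← qf]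

/-- Between two Hadamard gates on a qubit `h` that starts in `|1⟩` and is postselected on `|1⟩`, a
multiplication of amplitudes that depends on `h` is averaged. -/
lemma run_average {n : ℕ} {q : ℕ → Qubit} {h : ℕ} (hh : h < n) (qh : q h = ket true) {G : List Op}
    {g : Bool → ℝ} (hG : ∀ b, run n G (pstate n (Function.update q h (ket b))) =
      g b • pstate n (Function.update q h (ket b))) :
    run n (.had h :: (G ++ [.had h, .post h])) (pstate n q) =
      ((g false + g true) / 2) • pstate n q := by
  rw [run_cons, pstate_had hh qh, run_append]
  simp only [run_smul, run_add, hG]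
  rw [run_had_post hh (τ := false) (by simp),
    run_had_post hh (τ := true) (by simp), Function.update_idem, Function.update_idem, ← qh,
    Function.update_eq_self]
  simp only [smul_smul, ← add_smul, if_true]
  congr 1
  have h2 : (√2)⁻¹ * (√2)⁻¹ = (1 / 2 : ℝ) := by
    rw [← mul_inv, Real.mul_self_sqrt (by norm_num)]; norm_num
  simp
  linear_combination (g false + g true) * h2

/-! The work qubits are numbered from `D` on: `D` is constantly `|1⟩`, `D + 1` is a flag for
postselection, `D + 2` is an auxiliary coin, `D + 3` selects whether a term is added, and `D + 4`
holds a number `X` as `|0⟩ + X|1⟩`. -/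

/-- Multiplies the amplitude of `|1⟩` of the selector by the bit `c`. -/
def onBit (D c : ℕ) : List Op := [.tof (D + 3) D (D + 1), .tof (D + 3) c (D + 1), .post (D + 1)]

/-- Multiplies the amplitude of `|1⟩` of the selector by the negated bit `c`. -/
def offBit (D c : ℕ) : List Op := [.tof (D + 3) c (D + 1), .post (D + 1)]

/-- Multiplies the amplitude of `|1⟩` of the selector by `-1` if the bit `c` is set. -/
def signBit (D c : ℕ) : List Op := [.had (D + 2), .tof (D + 3) c (D + 2), .had (D + 2)]

/-- Halves the amplitude of `|1⟩` of the selector. -/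
def halve (D : ℕ) : List Op :=
  .had (D + 2) :: ([.tof (D + 2) (D + 3) (D + 1), .post (D + 1)] ++ [.had (D + 2), .post (D + 2)])

/-- Doubles the amplitude of `|1⟩` of the selector, up to a global factor. -/
def double (D : ℕ) : List Op :=
  .had (D + 2) :: ([.tof (D + 2) D (D + 1), .tof (D + 2) (D + 3) (D + 1), .post (D + 1)] ++
    [.had (D + 2), .post (D + 2)])

/-- The work qubits `D`, `D + 1` and `D + 2` are at rest, that is, `|1⟩`. -/
structure Rest (D : ℕ) (q : ℕ → Qubit) : Prop where
  one : q D = ket true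
  flag : q (D + 1) = ket true
  coin : q (D + 2) = ket true

/-- There are enough qubits, and those in `A` are not work qubits. -/
structure Layout (n D : ℕ) (A : Set ℕ) : Prop where
  width : D + 5 ≤ n
  lt : ∀ a ∈ A, a < n
  data : ∀ a ∈ A, a < D ∨ D + 5 ≤ a

/-- Up to a constant factor, `G` multiplies the amplitude of `|1⟩` of the selector by `g β`, where
`β` gives the values of the qubits in `A`. -/
def Weighs (n D : ℕ) (A : Set ℕ) (G : List Op) (g : (ℕ → Bool) → ℝ) : Prop :=
  ∃ c : ℝ, c ≠ 0 ∧ ∀ (q : ℕ → Qubit) (β : ℕ → Bool) (ω : Bool), Rest D q →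
    (∀ a ∈ A, q a = ket (β a)) → q (D + 3) = ket ω →
    run n G (pstate n q) = (c * if ω then g β else 1) • pstate n q

namespace Weighs

variable {n D : ℕ} {A : Set ℕ}

lemma append {G H : List Op} {g h : (ℕ → Bool) → ℝ} (hG : Weighs n D A G g)
    (hH : Weighs n D A H h) : Weighs n D A (G ++ H) fun β => g β * h β := by
  obtain ⟨c, hc, hG⟩ := hG
  obtain ⟨d, hd, hH⟩ := hH
  refine ⟨c * d, mul_ne_zero hc hd, fun q β ω hr hA hw => ?_⟩
  rw [run_append, hG q β ω hr hA hw, run_smul, hH q β ω hr hA hw, smul_smul]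
  congr 1
  split_ifs <;> ring

lemma repeated {G : List Op} {g : (ℕ → Bool) → ℝ} (hG : Weighs n D A G g) (e : ℕ) :
    Weighs n D A ((List.range e).flatMap fun _ => G) fun β => g β ^ e := by
  induction e with
  | zero => exact ⟨1, one_ne_zero, fun q β ω _ _ _ => by simp⟩
  | succ e ih => simpa [List.range_succ, pow_succ] using ih.append hG

lemma onBit (hl : Layout n D A) {c : ℕ} (hc : c ∈ A) :
    Weighs n D A (onBit D c) fun β => if β c then 1 else 0 := by
  have hn := hl.width
  have h1 := hl.lt c hc
  have h2 := hl.data c hc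
  refine ⟨1, one_ne_zero, fun q β ω hr hA hw => ?_⟩
  rw [PostBQP.onBit, run_kill_unless (by omega) h1 (by omega) (by omega) (by omega) (by omega)
    (by omega) (by omega) (by omega) hw (hA c hc) hr.flag hr.one]
  cases ω <;> cases hb : β c <;> simp [hb]

lemma offBit (hl : Layout n D A) {c : ℕ} (hc : c ∈ A) :
    Weighs n D A (offBit D c) fun β => if β c then 0 else 1 := by
  have hn := hl.width
  have h1 := hl.lt c hc
  have h2 := hl.data c hc
  refine ⟨1, one_ne_zero, fun q β ω hr hA hw => ?_⟩
  rw [PostBQP.offBit, run_kill (by omega) h1 (by omega) (by omega) (by omega)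
    (by omega) hw (hA c hc) hr.flag]
  cases ω <;> cases hb : β c <;> simp [hb]

lemma run_signBit (hn : D + 5 ≤ n) {c : ℕ} (hc : c < n) (hcD : c ≤ D ∨ D + 5 ≤ c) {q : ℕ → Qubit}
    {ω γ : Bool} (hr : Rest D q) (hw : q (D + 3) = ket ω) (qc : q c = ket γ) :
    run n (signBit D c) (pstate n q) = (if ω && γ then -1 else 1 : ℝ) • pstate n q := by
  have e1 : ∀ b, (Op.tof (D + 3) c (D + 2)).apply n
      (pstate n (Function.update q (D + 2) (ket b))) =
      pstate n (Function.update q (D + 2) (ket (xor b (ω && γ)))) := by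
    intro b
    have h3 : c ≠ D + 2 := by omega
    rw [pstate_tof (α := ω) (β := γ) (τ := b) (by omega) hc (by omega) (by omega) (by omega)
      (by omega) (by simp [hw]) (by simp [h3, qc]) (by simp), Function.update_idem]
  have e0 := pstate_had (n := n) (show D + 2 < n by omega) hr.coin
  have e2 : (Op.tof (D + 3) c (D + 2)).apply n ((Op.had (D + 2)).apply n (pstate n q)) =
      (if ω && γ then -1 else 1 : ℝ) • (Op.had (D + 2)).apply n (pstate n q) := by
    rw [e0, Op.apply_smul, Op.apply_add, Op.apply_smul, e1, e1]
    cases ω && γ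
    · simp
    · simp only [Bool.bne_true, Bool.not_false, Bool.not_true, if_true, smul_smul]
      module
  rw [signBit, run_cons, run_cons, run_cons, run_nil, e2, Op.apply_smul,
    had_had n (by omega)]

lemma signBit (hl : Layout n D A) {c : ℕ} (hc : c ∈ A) :
    Weighs n D A (signBit D c) fun β => if β c then -1 else 1 := by
  have h2 := hl.data c hc
  refine ⟨1, one_ne_zero, fun q β ω hr hA hw => ?_⟩
  rw [run_signBit hl.width (hl.lt c hc) (by omega) hr hw (hA c hc)]
  cases ω <;> cases hb : β c <;> simp [hb]

lemma neg (hl : Layout n D A) : Weighs n D A (PostBQP.signBit D D) fun _ => -1 := by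
  have hn := hl.width
  refine ⟨1, one_ne_zero, fun q β ω hr hA hw => ?_⟩
  rw [run_signBit hn (by omega) (by omega) hr hw hr.one]
  cases ω <;> simp

lemma halve (hl : Layout n D A) : Weighs n D A (halve D) fun _ => 1 / 2 := by
  have hn := hl.width
  refine ⟨1, one_ne_zero, fun q β ω hr hA hw => ?_⟩
  rw [PostBQP.halve, run_average (g := fun b => if b && ω then 0 else 1) (by omega) hr.coin]
  · congr 1
    cases ω <;> norm_num
  · intro b
    exact run_kill (by omega) (by omega) (by omega) (by omega) (by omega) (by omega) (by simp)
      (by simp [hw]) (by simp [hr.flag])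

lemma double (hl : Layout n D A) : Weighs n D A (double D) fun _ => 2 := by
  have hn := hl.width
  refine ⟨1 / 2, by norm_num, fun q β ω hr hA hw => ?_⟩
  rw [PostBQP.double, run_average (g := fun b => if b && !ω then 0 else 1) (by omega) hr.coin]
  · congr 1
    cases ω <;> norm_num
  · intro b
    exact run_kill_unless (by omega) (by omega) (by omega) (by omega) (by omega) (by omega)
      (by omega) (by omega) (by omega) (by simp) (by simp [hw]) (by simp [hr.flag])
      (by simp [hr.one])

end Weighs

/-! ### Sums of weights -/

/-- Adds the weight that the gadget `G` gives to the selector to the number on qubit `D + 4`. -/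
def addTerm (D : ℕ) (G : List Op) : List Op :=
  .had (D + 3) :: (G ++ ([.tof (D + 3) (D + 4) (D + 1), .post (D + 1)] ++
    (.tof (D + 3) D (D + 4) :: [.had (D + 3), .post (D + 3)])))

/-- The vector `|0⟩ + X|1⟩` that represents the number `X`. -/
noncomputable def numberKet (X : ℝ) : Qubit := ket false + X • ket true

/-- Up to a constant factor, `L` adds `g β` to the number on qubit `D + 4`, where `β` gives the
values of the qubits in `A`. -/
def Adds (n D : ℕ) (A : Set ℕ) (L : List Op) (g : (ℕ → Bool) → ℝ) : Prop :=
  ∃ C : ℝ, C ≠ 0 ∧ ∀ (q : ℕ → Qubit) (β : ℕ → Bool), Rest D q → q (D + 3) = ket true →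
    (∀ a ∈ A, q a = ket (β a)) → ∀ X : ℝ,
    run n L (pstate n (Function.update q (D + 4) (numberKet X))) =
      C • pstate n (Function.update q (D + 4) (numberKet (X + g β)))

lemma pstate_numberKet {n i : ℕ} (hi : i < n) (q : ℕ → Qubit) (X : ℝ) :
    pstate n (Function.update q i (numberKet X)) =
      pstate n (Function.update q i (ket false)) +
        X • pstate n (Function.update q i (ket true)) := by
  rw [numberKet, pstate_update_add q hi, pstate_update_smul q hi]

namespace Adds

variable {n D : ℕ} {A : Set ℕ}

lemma nil : Adds n D A [] fun _ => 0 := ⟨1, one_ne_zero, fun q β _ _ _ X => by simp⟩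

lemma append {L M : List Op} {g h : (ℕ → Bool) → ℝ} (hL : Adds n D A L g) (hM : Adds n D A M h) :
    Adds n D A (L ++ M) fun β => g β + h β := by
  obtain ⟨c, hc, hL⟩ := hL
  obtain ⟨d, hd, hM⟩ := hM
  refine ⟨c * d, mul_ne_zero hc hd, fun q β hr hw hA X => ?_⟩
  rw [run_append, hL q β hr hw hA, run_smul, hM q β hr hw hA, smul_smul, add_assoc]

lemma flatMap_range {m : ℕ} {F : ℕ → List Op} {g : ℕ → (ℕ → Bool) → ℝ}
    (h : ∀ i < m, Adds n D A (F i) (g i)) :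
    Adds n D A ((List.range m).flatMap F) fun β => ∑ i ∈ Finset.range m, g i β := by
  induction m with
  | zero => simpa using nil
  | succ m ih =>
    simpa [List.range_succ, Finset.sum_range_succ] using
      (ih fun i hi => h i (by omega)).append (h m (by omega))

lemma flatMap_bool {F : Bool → List Op} {g : Bool → (ℕ → Bool) → ℝ}
    (h : ∀ b, Adds n D A (F b) (g b)) :
    Adds n D A ([false, true].flatMap F) fun β => ∑ b, g b β := by
  simpa [add_comm] using (h false).append (h true)

lemma addTerm (hl : Layout n D A) {G : List Op} {g : (ℕ → Bool) → ℝ} (hG : Weighs n D A G g) :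
    Adds n D A (addTerm D G) g := by
  have hn := hl.width
  obtain ⟨c, hc, hG⟩ := hG
  refine ⟨c / 2, div_ne_zero hc two_ne_zero, fun q β hr hw hA X => ?_⟩
  have hdata : ∀ a ∈ A, a ≠ D + 3 ∧ a ≠ D + 4 := by
    intro a ha
    have := hl.data a ha
    omega
  -- The branch of the selector `ω`, when the number qubit is `b`.
  have branch : ∀ b ω, run n (G ++ ([.tof (D + 3) (D + 4) (D + 1), .post (D + 1)] ++
      (.tof (D + 3) D (D + 4) :: [.had (D + 3), .post (D + 3)])))
      (pstate n (Function.update (Function.update q (D + 4) (ket b)) (D + 3) (ket ω))) =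
      ((√2)⁻¹ * c * (if ω then -g β else 1) * (if ω && b then 0 else 1)) •
        pstate n (Function.update q (D + 4) (ket (xor b ω))) := by
    intro b ω
    rw [run_append, hG _ β ω ⟨by simp [hr.one], by simp [hr.flag], by simp [hr.coin]⟩
      (fun a ha => by simp [hdata a ha, hA a ha]) (by simp), run_smul, run_append,
      run_kill (ξ := ω) (γ := b) (by omega) (by omega) (by omega) (by omega) (by omega) (by omega)
        (by simp) (by simp) (by simp [hr.flag]), run_smul, run_cons,
      pstate_tof (α := ω) (β := true) (τ := b) (by omega) (by omega) (by omega) (by omega)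
        (by omega) (by omega) (by simp) (by simp [hr.one]) (by simp),
      run_had_post (τ := ω) (by omega) (by simp), smul_smul, smul_smul]
    have hq : Function.update (Function.update (Function.update (Function.update q (D + 4) (ket b))
        (D + 3) (ket ω)) (D + 4) (ket (xor b (ω && true)))) (D + 3) (ket true) =
        Function.update q (D + 4) (ket (xor b ω)) := by
      funext i
      rcases eq_or_ne i (D + 3) with rfl | h3
      · simp [hw]
      · rcases eq_or_ne i (D + 4) with rfl | h4
        · simp
        · simp [h3, h4]
    rw [hq]
    congr 1
    cases ω <;> cases b <;> simp <;> ring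
  have h2 : (√2)⁻¹ * (√2)⁻¹ = (1 / 2 : ℝ) := by
    rw [← mul_inv, Real.mul_self_sqrt (by norm_num)]; norm_num
  have hb : ∀ b, run n (PostBQP.addTerm D G) (pstate n (Function.update q (D + 4) (ket b))) =
      (c / 2) • (pstate n (Function.update q (D + 4) (ket b)) +
        (if b then 0 else g β) • pstate n (Function.update q (D + 4) (ket true))) := by
    intro b
    rw [PostBQP.addTerm, run_cons, pstate_had (τ := true) (by omega) (by simp [hw]), run_smul,
      run_add, run_smul, branch, branch]
    simp only [smul_add, smul_smul]
    congr 1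
    · simp only [Bool.bne_false, Bool.false_and, if_false, mul_one, Bool.false_eq_true]
      congr 1
      linear_combination c * h2
    · cases b
      · simp only [Bool.bne_true, Bool.not_false, if_true, Bool.and_false, if_false,
          Bool.false_eq_true]
        congr 1
        linear_combination c * g β * h2
      · simp
  rw [pstate_numberKet (by omega), pstate_numberKet (by omega), run_add, run_smul, hb, hb]
  simp only [if_true, Bool.false_eq_true, if_false]
  module

end Adds

/-! ### The quadratic form -/

/-- The selector survives only if bit `k` is `κ`. -/
def selectBit (D k : ℕ) (κ : Bool) : List Op := if κ then onBit D k else offBit D k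

/-- The gadget `G`, `e` times. -/
def repeated (e : ℕ) (G : List Op) : List Op := (List.range e).flatMap fun _ => G

/-- The qubit that holds bit `r` of the real part (`c = false`) or of the imaginary part
(`c = true`) of the coefficient of `|κ⟩` of the described vector. The description starts at qubit
`K`, and each of its numbers has `B + 1` bits. -/
def descQubit (K B : ℕ) (c κ : Bool) (r : ℕ) : ℕ := K + (2 * κ.toNat + c.toNat) * (B + 1) + r

/-- The weight of one product of two bits of the coefficients of `|κ₁⟩` and `|κ₂⟩`, where the bits
`k₁` and `k₂` have the values `κ₁` and `κ₂`. -/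
def productWeight (D K B k₁ k₂ : ℕ) (c κ₁ κ₂ : Bool) (r₁ r₂ : ℕ) : List Op :=
  selectBit D k₁ κ₁ ++ selectBit D k₂ κ₂ ++ onBit D (descQubit K B c κ₁ r₁) ++
    onBit D (descQubit K B c κ₂ r₂) ++ signBit D (descQubit K B c κ₁ B) ++
    signBit D (descQubit K B c κ₂ B) ++ repeated r₁ (double D) ++ repeated r₂ (double D)

/-- The negative weight `-2 ^ B / 2 ^ e`, if the bits `k₁` and `k₂` are both `κ`, times the
weight of `G`. -/
def diagonalWeight (D B k₁ k₂ : ℕ) (κ : Bool) (G : List Op) (e : ℕ) : List Op :=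
  selectBit D k₁ κ ++ selectBit D k₂ κ ++ signBit D D ++ G ++ repeated B (double D) ++
    repeated e (halve D)

/-- Adds the products of the coefficients that belong to the values of the bits `k₁` and `k₂`. -/
def addProducts (D K B k₁ k₂ : ℕ) : List Op :=
  [false, true].flatMap fun c => [false, true].flatMap fun κ₁ => [false, true].flatMap fun κ₂ =>
    (List.range B).flatMap fun r₁ => (List.range B).flatMap fun r₂ =>
      addTerm D (productWeight D K B k₁ k₂ c κ₁ κ₂ r₁ r₂)

/-- Subtracts the threshold of stage `j`, which is given by the previous output qubits, and, with a
sign that depends on the output qubit of stage `j`, the number `2⁻ⁱ`. -/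
def addThreshold (D B j i k₁ k₂ : ℕ) : List Op :=
  [false, true].flatMap fun κ =>
    (List.range j).flatMap (fun s =>
      addTerm D (diagonalWeight D B k₁ k₂ κ (onBit D (D + 5 + s)) (s + 1))) ++
    (addTerm D (diagonalWeight D B k₁ k₂ κ [] (j + 1)) ++
    addTerm D (diagonalWeight D B k₁ k₂ κ (signBit D (D + 5 + j)) i))

/-- Projects qubit `k` to `|0⟩ + |1⟩` and leaves it in `|1⟩`. -/
def merge (D k : ℕ) : List Op := [.had k, .tof D (D + 2) k, .post k]

/-- Multiplies the state by the number that `L` computes, and adds up the branches that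
differ in the qubits `k₁` and `k₂`. -/
def multiply (D : ℕ) (L : List Op) (k₁ k₂ : ℕ) : List Op :=
  .tof D (D + 2) (D + 4) :: (L ++ (.post (D + 4) :: (merge D k₁ ++ merge D k₂)))

/-- The multiplication of the amplitude by `x ± 2⁻ⁱ`, where `x` is the difference between the
squared inner product and the threshold of stage `j`. It uses up the copies `k₁` and
`k₂` of the state. -/
def factor (D K B j i k₁ k₂ : ℕ) : List Op :=
  multiply D (addProducts D K B k₁ k₂ ++ addThreshold D B j i k₁ k₂) k₁ k₂

lemma run_merge {n D : ℕ} {q : ℕ → Qubit} (hr : Rest D q) (hn : D + 5 ≤ n) {k : ℕ} (hk : k < D)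
    {κ : Bool} (hq : q k = ket κ) :
    run n (merge D k) (pstate n q) = (√2)⁻¹ • pstate n (Function.update q k (ket true)) := by
  have h1 : D ≠ k := by omega
  have h2 : D + 2 ≠ k := by omega
  have e : ∀ b, run n [.tof D (D + 2) k, .post k] (pstate n (Function.update q k (ket b))) =
      (if b then 0 else 1 : ℝ) • pstate n (Function.update q k (ket true)) := by
    intro b
    rw [run_cons, pstate_tof (α := true) (β := true) (τ := b) (by omega) (by omega) (by omega)
      (by omega) h1 h2 (by simp [h1, hr.one]) (by simp [h2, hr.coin]) (by simp), run_cons,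
      pstate_post (τ := xor b (true && true)) (by omega) (by simp), run_nil, Function.update_idem]
    cases b <;> simp
  rw [merge, run_cons, pstate_had (by omega) hq, run_smul, run_add, run_smul, e, e]
  simp

lemma Weighs.selectBit {n D : ℕ} {A : Set ℕ} (hl : Layout n D A) {k : ℕ} (hk : k ∈ A) (κ : Bool) :
    Weighs n D A (selectBit D k κ) fun β => if β k = κ then 1 else 0 := by
  cases κ
  · have := offBit hl hk
    simp only [PostBQP.selectBit, Bool.false_eq_true, if_false]
    convert this using 2 with β
    cases β k <;> simp
  · simpa [PostBQP.selectBit] using onBit hl hk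

lemma Weighs.congr {n D : ℕ} {A : Set ℕ} {G : List Op} {g h : (ℕ → Bool) → ℝ}
    (hG : Weighs n D A G g) (e : ∀ β, g β = h β) : Weighs n D A G h := by
  rwa [← funext e]

lemma Adds.congr {n D : ℕ} {A : Set ℕ} {L : List Op} {g h : (ℕ → Bool) → ℝ}
    (hL : Adds n D A L g) (e : ∀ β, g β = h β) : Adds n D A L h := by
  rwa [← funext e]

/-- A number of the description, as an integer: the represented number is this times
`2 ^ (-B / 2)`. -/
noncomputable def descNumber (K B : ℕ) (β : ℕ → Bool) (c κ : Bool) : ℝ :=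
  (if β (descQubit K B c κ B) then -1 else 1) *
    ∑ r ∈ Finset.range B, if β (descQubit K B c κ r) then (2 : ℝ) ^ r else 0

lemma adds_products {n D K B k₁ k₂ : ℕ} {A : Set ℕ} (hl : Layout n D A) (h₁ : k₁ ∈ A)
    (h₂ : k₂ ∈ A) (hA : ∀ c κ r, r ≤ B → descQubit K B c κ r ∈ A) :
    Adds n D A (addProducts D K B k₁ k₂) fun β =>
      ∑ c, descNumber K B β c (β k₁) * descNumber K B β c (β k₂) := by
  have h := Adds.flatMap_bool fun c => Adds.flatMap_bool fun κ₁ => Adds.flatMap_bool fun κ₂ =>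
    Adds.flatMap_range (m := B) fun r₁ hr₁ => Adds.flatMap_range (m := B) fun r₂ hr₂ =>
      Adds.addTerm hl
        ((((((((Weighs.selectBit hl h₁ κ₁).append (Weighs.selectBit hl h₂ κ₂)).append
        (Weighs.onBit hl (hA c κ₁ r₁ hr₁.le))).append (Weighs.onBit hl (hA c κ₂ r₂ hr₂.le))).append
        (Weighs.signBit hl (hA c κ₁ B le_rfl))).append
        (Weighs.signBit hl (hA c κ₂ B le_rfl))).append
        ((Weighs.double hl).repeated r₁)).append ((Weighs.double hl).repeated r₂))
  refine h.congr fun β => ?_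
  refine Finset.sum_congr rfl fun c _ => ?_
  have inner : ∀ κ₁ κ₂ : Bool, (∑ r₁ ∈ Finset.range B, ∑ r₂ ∈ Finset.range B,
      (if β k₁ = κ₁ then (1 : ℝ) else 0) * (if β k₂ = κ₂ then 1 else 0) *
      (if β (descQubit K B c κ₁ r₁) then 1 else 0) * (if β (descQubit K B c κ₂ r₂) then 1 else 0) *
      (if β (descQubit K B c κ₁ B) then -1 else 1) * (if β (descQubit K B c κ₂ B) then -1 else 1) *
      2 ^ r₁ * 2 ^ r₂) =
      (if β k₁ = κ₁ then 1 else 0) * (if β k₂ = κ₂ then 1 else 0) *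
        (descNumber K B β c κ₁ * descNumber K B β c κ₂) := by
    intro κ₁ κ₂
    rw [descNumber, descNumber, show ∀ a b c d e f : ℝ, a * b * (c * d * (e * f)) =
      a * b * c * e * (d * f) by intros; ring, Finset.sum_mul_sum, Finset.mul_sum]
    refine Finset.sum_congr rfl fun r₁ _ => ?_
    rw [Finset.mul_sum]
    refine Finset.sum_congr rfl fun r₂ _ => ?_
    by_cases a : β (descQubit K B c κ₁ r₁) <;> by_cases b : β (descQubit K B c κ₂ r₂) <;>
      simp only [a, b, if_true, if_false, Bool.false_eq_true] <;> ring
  simp only [inner, Fintype.sum_bool]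
  cases β k₁ <;> cases β k₂ <;> simp

/-- The binary number `0.v₀v₁…` with `j` digits. -/
noncomputable def binaryValue (v : ℕ → Bool) (j : ℕ) : ℝ :=
  ∑ s ∈ Finset.range j, (if v s then 1 else 0) * (1 / 2 : ℝ) ^ (s + 1)

/-- The threshold of stage `j`: the middle of the interval of the numbers whose first `j` digits
are `v`. -/
noncomputable def threshold (v : ℕ → Bool) (j : ℕ) : ℝ := binaryValue v j + (1 / 2) ^ (j + 1)

lemma weighs_diagonal {n D B k₁ k₂ : ℕ} {A : Set ℕ} (hl : Layout n D A) (h₁ : k₁ ∈ A)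
    (h₂ : k₂ ∈ A) (κ : Bool) {G : List Op} {g : (ℕ → Bool) → ℝ} (hG : Weighs n D A G g) (e : ℕ) :
    Weighs n D A (diagonalWeight D B k₁ k₂ κ G e) fun β =>
      (if β k₁ = κ then 1 else 0) * (if β k₂ = κ then 1 else 0) * (-2 ^ B * (g β * (1 / 2) ^ e)) :=
  ((((((Weighs.selectBit hl h₁ κ).append (Weighs.selectBit hl h₂ κ)).append (Weighs.neg hl)).append
    hG).append ((Weighs.double hl).repeated B)).append ((Weighs.halve hl).repeated e)).congr
      fun β => by ring

lemma adds_threshold {n D B j i k₁ k₂ : ℕ} {A : Set ℕ} (hl : Layout n D A) (h₁ : k₁ ∈ A)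
    (h₂ : k₂ ∈ A) (hA : ∀ s ≤ j, D + 5 + s ∈ A) :
    Adds n D A (addThreshold D B j i k₁ k₂) fun β =>
      (if β k₁ = β k₂ then 1 else 0) * (-2 ^ B * (threshold (fun s => β (D + 5 + s)) j +
        (if β (D + 5 + j) then -1 else 1) * (1 / 2) ^ i)) := by
  have hnil : Weighs n D A [] fun _ => 1 := ⟨1, one_ne_zero, fun q β ω _ _ _ => by simp⟩
  have h := Adds.flatMap_bool fun κ =>
    (Adds.flatMap_range (m := j) fun s hs => Adds.addTerm hl
      (weighs_diagonal (B := B) hl h₁ h₂ κ (Weighs.onBit hl (hA s hs.le)) (s + 1))).append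
    ((Adds.addTerm hl (weighs_diagonal (B := B) hl h₁ h₂ κ hnil (j + 1))).append
    (Adds.addTerm hl (weighs_diagonal (B := B) hl h₁ h₂ κ (Weighs.signBit hl (hA j le_rfl)) i)))
  refine h.congr fun β => ?_
  simp only [← Finset.mul_sum, threshold, binaryValue, Fintype.sum_bool]
  cases β k₁ <;> cases β k₂ <;> cases β (D + 5 + j) <;> simp <;> ring

lemma run_multiply {n D k₁ k₂ : ℕ} {A : Set ℕ} {L : List Op} {g : (ℕ → Bool) → ℝ}
    (hl : Layout n D A) (hL : Adds n D A L g) (h₁ : k₁ ∈ A) (h₂ : k₂ ∈ A) (hk₁ : k₁ < D)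
    (hk₂ : k₂ < D) (hne : k₁ ≠ k₂) :
    ∃ C : ℝ, C ≠ 0 ∧ ∀ (q : ℕ → Qubit) (β : ℕ → Bool), Rest D q → q (D + 3) = ket true →
      q (D + 4) = ket true → (∀ a ∈ A, q a = ket (β a)) →
      run n (multiply D L k₁ k₂) (pstate n q) = (C * g β) •
        pstate n (Function.update (Function.update q k₁ (ket true)) k₂ (ket true)) := by
  have hn := hl.width
  obtain ⟨C, hC, hL⟩ := hL
  refine ⟨C * ((√2)⁻¹ * (√2)⁻¹), by positivity, fun q β hr hw hu hA => ?_⟩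
  have e0 : pstate n (Function.update q (D + 4) (ket false)) =
      pstate n (Function.update q (D + 4) (numberKet 0)) := by simp [numberKet]
  have e1 : run n [.post (D + 4)] (pstate n (Function.update q (D + 4) (numberKet (0 + g β)))) =
      g β • pstate n q := by
    rw [pstate_numberKet (by omega), run_add, run_smul, run_cons, run_cons,
      pstate_post (τ := false) (by omega) (by simp), pstate_post (τ := true) (by omega) (by simp),
      ← hu, Function.update_eq_self]
    simp
  have hr' : Rest D (Function.update q k₁ (ket true)) := by
    have a : D ≠ k₁ := by omega
    have b : D + 1 ≠ k₁ := by omega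
    have c : D + 2 ≠ k₁ := by omega
    exact ⟨by simp [a, hr.one], by simp [b, hr.flag], by simp [c, hr.coin]⟩
  rw [multiply, run_cons, pstate_tof (by omega) (by omega) (by omega) (by omega) (by omega)
    (by omega) hr.one hr.coin hu, run_append]
  rw [show xor true (true && true) = false from rfl, e0, hL q β hr hw hA, run_smul,
    ← List.singleton_append, run_append, e1, run_smul, run_append,
    run_merge hr hn hk₁ (hA k₁ h₁), run_smul, run_merge hr' hn hk₂ (κ := β k₂)
      (by simp [hne.symm, hA k₂ h₂])]
  simp only [smul_smul]
  congr 1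
  ring

/-- The real superposition `γ false |0⟩ + γ true |1⟩`. -/
noncomputable def realKet (γ : Bool → ℝ) : Qubit := γ false • ket false + γ true • ket true

lemma pstate_realKet {n i : ℕ} (hi : i < n) {q : ℕ → Qubit} {γ : Bool → ℝ} (hq : q i = realKet γ) :
    pstate n q = ∑ κ, γ κ • pstate n (Function.update q i (ket κ)) := by
  conv_lhs => rw [← Function.update_eq_self i q, hq, realKet]
  rw [pstate_update_add q hi, pstate_update_smul q hi, pstate_update_smul q hi]
  simp [add_comm]

/-- On two copies of the state the weights add up to a quadratic form in its amplitudes. -/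
lemma run_multiply_copies {n D k₁ k₂ : ℕ} {A : Set ℕ} {L : List Op} {g : (ℕ → Bool) → ℝ}
    (hl : Layout n D A) (hL : Adds n D A L g) (h₁ : k₁ ∈ A) (h₂ : k₂ ∈ A) (hk₁ : k₁ < D)
    (hk₂ : k₂ < D) (hne : k₁ ≠ k₂) :
    ∃ C : ℝ, C ≠ 0 ∧ ∀ (q : ℕ → Qubit) (β : ℕ → Bool) (γ : Bool → ℝ), Rest D q →
      q (D + 3) = ket true → q (D + 4) = ket true → q k₁ = realKet γ → q k₂ = realKet γ →
      (∀ a ∈ A, a ≠ k₁ → a ≠ k₂ → q a = ket (β a)) →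
      run n (multiply D L k₁ k₂) (pstate n q) =
        (C * ∑ κ₁, ∑ κ₂, γ κ₁ * γ κ₂ *
          g (Function.update (Function.update β k₁ κ₁) k₂ κ₂)) •
        pstate n (Function.update (Function.update q k₁ (ket true)) k₂ (ket true)) := by
  obtain ⟨C, hC, h⟩ := run_multiply hl hL h₁ h₂ hk₁ hk₂ hne
  refine ⟨C, hC, fun q β γ hr hw hu q₁ q₂ hA => ?_⟩
  have hn := hl.width
  have key : ∀ κ₁ κ₂, run n (multiply D L k₁ k₂)
      (pstate n (Function.update (Function.update q k₁ (ket κ₁)) k₂ (ket κ₂))) =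
      (C * g (Function.update (Function.update β k₁ κ₁) k₂ κ₂)) •
        pstate n (Function.update (Function.update q k₁ (ket true)) k₂ (ket true)) := by
    intro κ₁ κ₂
    have up : ∀ x, D ≤ x → Function.update (Function.update q k₁ (ket κ₁)) k₂ (ket κ₂) x = q x := by
      intro x hx
      rw [Function.update_of_ne (by omega), Function.update_of_ne (by omega)]
    rw [h _ (Function.update (Function.update β k₁ κ₁) k₂ κ₂)
      ⟨by rw [up _ (by omega), hr.one], by rw [up _ (by omega), hr.flag],
        by rw [up _ (by omega), hr.coin]⟩ (by rw [up _ (by omega), hw])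
      (by rw [up _ (by omega), hu])]
    · congr 2
      funext x
      rcases eq_or_ne x k₂ with rfl | h2
      · simp
      · rcases eq_or_ne x k₁ with rfl | h1
        · simp [h2]
        · simp [h1, h2]
    · intro a ha
      rcases eq_or_ne a k₂ with rfl | h2
      · simp
      · rcases eq_or_ne a k₁ with rfl | h1
        · simp [h2]
        · simp [h1, h2, hA a ha h1 h2]
  rw [pstate_realKet (i := k₁) (by omega) q₁]
  have exp2 : ∀ κ₁, pstate n (Function.update q k₁ (ket κ₁)) = ∑ κ₂, γ κ₂ •
      pstate n (Function.update (Function.update q k₁ (ket κ₁)) k₂ (ket κ₂)) := fun κ₁ =>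
    pstate_realKet (i := k₂) (by omega) (by simp [hne.symm, q₂])
  simp only [exp2, Fintype.sum_bool, run_add, run_smul, key]
  module

/-- The set of the qubits that control the gadgets of stage `j`. -/
def controls (D K j k₁ k₂ : ℕ) : Set ℕ :=
  {a | a = k₁ ∨ a = k₂ ∨ (K ≤ a ∧ a < D) ∨ (D + 5 ≤ a ∧ a ≤ D + 5 + j)}

lemma descQubit_mem {D K B : ℕ} (hD : D = K + 4 * (B + 1)) (c κ : Bool) {r : ℕ} (hr : r ≤ B) :
    K ≤ descQubit K B c κ r ∧ descQubit K B c κ r < D := by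
  cases c <;> cases κ <;> simp [descQubit] <;> omega

/-- On two copies of a unit vector, the factor multiplies the state by the squared inner product
minus the threshold, minus or plus `2⁻ⁱ`; the norm `∑ κ, γ κ ^ 2` makes the threshold a quadratic
form in the amplitudes, too. -/
lemma run_factor {n D K B j k₁ k₂ : ℕ} (i : ℕ) (hD : D = K + 4 * (B + 1)) (hn : D + 5 + j < n)
    (hk₁ : k₁ < K) (hk₂ : k₂ < K) (hne : k₁ ≠ k₂) :
    ∃ C : ℝ, C ≠ 0 ∧ ∀ (q : ℕ → Qubit) (β : ℕ → Bool) (γ : Bool → ℝ), Rest D q →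
      q (D + 3) = ket true → q (D + 4) = ket true → q k₁ = realKet γ → q k₂ = realKet γ →
      (∀ a, (K ≤ a ∧ a < D) ∨ (D + 5 ≤ a ∧ a ≤ D + 5 + j) → q a = ket (β a)) →
      run n (factor D K B j i k₁ k₂) (pstate n q) =
        (C * (∑ c, (∑ κ, γ κ * descNumber K B β c κ) ^ 2 -
          2 ^ B * (∑ κ, γ κ ^ 2) * (threshold (fun s => β (D + 5 + s)) j +
            (if β (D + 5 + j) then -1 else 1) * (1 / 2) ^ i))) •
        pstate n (Function.update (Function.update q k₁ (ket true)) k₂ (ket true)) := by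
  set A := controls D K j k₁ k₂ with hA
  have hl : Layout n D A := by
    refine ⟨by omega, fun a ha => ?_, fun a ha => ?_⟩ <;>
    · simp only [hA, controls, Set.mem_ofPred_eq] at ha
      omega
  have m₁ : k₁ ∈ A := by simp [hA, controls]
  have m₂ : k₂ ∈ A := by simp [hA, controls]
  have hd : ∀ c κ r, r ≤ B → descQubit K B c κ r ∈ A := fun c κ r hr =>
    Or.inr (Or.inr (Or.inl (descQubit_mem hD c κ hr)))
  have ho : ∀ s ≤ j, D + 5 + s ∈ A := fun s hs => Or.inr (Or.inr (Or.inr (by omega)))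
  obtain ⟨C, hC, h⟩ := run_multiply_copies hl
    ((adds_products (K := K) hl m₁ m₂ hd).append (adds_threshold (B := B) (i := i) hl m₁ m₂ ho))
    m₁ m₂ (by omega) (by omega) hne
  refine ⟨C, hC, fun q β γ hr hw hu q₁ q₂ hq => ?_⟩
  rw [factor, h q β γ hr hw hu q₁ q₂ fun a ha h1 h2 => hq a (by
    simp only [hA, controls, Set.mem_ofPred_eq] at ha
    tauto)]
  congr 2
  have up : ∀ κ₁ κ₂ x, K ≤ x →
      Function.update (Function.update β k₁ κ₁) k₂ κ₂ x = β x := by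
    intro κ₁ κ₂ x hx
    rw [Function.update_of_ne (by omega), Function.update_of_ne (by omega)]
  have u1 : ∀ κ₁ κ₂ c κ, descNumber K B (Function.update (Function.update β k₁ κ₁) k₂ κ₂) c κ =
      descNumber K B β c κ := by
    intro κ₁ κ₂ c κ
    simp only [descNumber]
    rw [up _ _ _ (descQubit_mem hD c κ le_rfl).1]
    congr 1
    refine Finset.sum_congr rfl fun r hr => ?_
    rw [up _ _ _ (descQubit_mem hD c κ (Finset.mem_range.1 hr).le).1]
  have u2 : ∀ κ₁ κ₂ s, Function.update (Function.update β k₁ κ₁) k₂ κ₂ (D + 5 + s) =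
      β (D + 5 + s) := fun κ₁ κ₂ s => up _ _ _ (by omega)
  simp only [u1, u2, Function.update_self, Function.update_of_ne hne, Fintype.sum_bool]
  simp
  ring

/-! ### Probabilities of outcomes -/

lemma normSq_nonneg {n : ℕ} (φ : State n) : 0 ≤ normSq φ :=
  Finset.sum_nonneg fun _ _ => by positivity

lemma normSq_smul {n : ℕ} (r : ℝ) (φ : State n) : normSq (r • φ) = r ^ 2 * normSq φ := by
  simp [normSq, Finset.mul_sum, mul_pow]

lemma normSq_project_add {n : ℕ} (i : Fin n) (φ : State n) :
    normSq (project i true φ) + normSq (project i false φ) = normSq φ := by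
  rw [normSq, normSq, ← Finset.sum_add_distrib]
  refine Finset.sum_congr rfl fun x _ => ?_
  cases h : x i <;> simp [project, h]

lemma normSq_indicator_le {n : ℕ} (E : Set (Fin n → Bool)) (φ : State n) :
    normSq (E.indicator φ) ≤ normSq φ := by
  refine Finset.sum_le_sum fun x _ => ?_
  by_cases h : x ∈ E <;> simp [h]

lemma outcomeProb_mem_Icc {n : ℕ} (gs : List (Gate n)) (φ : State n) (E : Set (Fin n → Bool)) :
    outcomeProb gs φ E ∈ Set.Icc (0 : ℝ) 1 := by
  induction gs generalizing φ with
  | nil => exact ⟨div_nonneg (normSq_nonneg _) (normSq_nonneg _),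
      div_le_one_of_le₀ (normSq_indicator_le E φ) (normSq_nonneg _)⟩
  | cons g gs ih =>
    cases g with
    | hadamard i => exact ih _
    | toffoli a b t => exact ih _
    | postselect i => exact ih _
    | measure i =>
      have h1 := ih (project i true φ)
      have h0 := ih (project i false φ)
      have hp : ∀ r, 0 ≤ normSq (project i r φ) / normSq φ := fun r =>
        div_nonneg (normSq_nonneg _) (normSq_nonneg _)
      have hs : normSq (project i true φ) / normSq φ +
          normSq (project i false φ) / normSq φ ≤ 1 := by
        rw [← add_div, normSq_project_add]
        exact div_self_le_one _
      simp only [outcomeProb, Fintype.sum_bool]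
      refine ⟨add_nonneg (mul_nonneg (hp _) h1.1) (mul_nonneg (hp _) h0.1), ?_⟩
      have := mul_le_of_le_one_right (hp true) h1.2
      have := mul_le_of_le_one_right (hp false) h0.2
      linarith

lemma project_smul {n : ℕ} (i : Fin n) (b : Bool) (r : ℝ) (φ : State n) :
    project i b (r • φ) = r • project i b φ := by
  funext x
  simp only [project, Pi.smul_apply]
  split_ifs <;> simp

lemma outcomeProb_smul {n : ℕ} (gs : List (Gate n)) {r : ℝ} (hr : r ≠ 0) (φ : State n)
    (E : Set (Fin n → Bool)) : outcomeProb gs (r • φ) E = outcomeProb gs φ E := by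
  have hr2 : r ^ 2 ≠ 0 := pow_ne_zero 2 hr
  induction gs generalizing φ with
  | nil =>
    simp only [outcomeProb]
    rw [show E.indicator (r • φ) = r • E.indicator φ from Set.indicator_const_smul E r φ,
      normSq_smul, normSq_smul, mul_div_mul_left _ _ hr2]
  | cons g gs ih =>
    cases g with
    | hadamard i =>
      have := Op.apply_smul n (.had i) r φ
      simp only [Op.apply, i.2, dif_pos] at this
      simp only [outcomeProb, this, ih]
    | toffoli a b t hab hat hbt =>
      exact ih (applyToffoli a b t φ)
    | postselect i => simp only [outcomeProb, project_smul, ih]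
    | measure i =>
      simp only [outcomeProb, project_smul, ih, normSq_smul, mul_div_mul_left _ _ hr2]

/-- A measurement of a superposition of unit vectors `χ r` in which the qubit is `r`. -/
lemma outcomeProb_measure {n : ℕ} (gs : List (Gate n)) (i : Fin n) (φ : State n)
    (E : Set (Fin n → Bool)) (a : Bool → ℝ) (χ : Bool → State n)
    (hφ : ∀ r, project i r φ = a r • χ r) (hχ : ∀ r, normSq (χ r) = 1) :
    outcomeProb (.measure i :: gs) φ E =
      ∑ r, a r ^ 2 / (a true ^ 2 + a false ^ 2) * outcomeProb gs (χ r) E := by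
  simp only [outcomeProb]
  refine Finset.sum_congr rfl fun r _ => ?_
  rw [← normSq_project_add i φ, hφ, hφ, hφ]
  simp only [normSq_smul, hχ, mul_one]
  by_cases h : a r = 0
  · simp [h]
  · rw [outcomeProb_smul _ h]

lemma normSq_pstate {n : ℕ} {q : ℕ → Qubit}
    (hq : ∀ a, ‖q a 0‖ ^ 2 + ‖q a 1‖ ^ 2 = 1) : normSq (pstate n q) = 1 := by
  have : ∀ x : Fin n → Bool, ‖pstate n q x‖ ^ 2 =
      ∏ i : Fin n, ‖q i (if x i then 1 else 0)‖ ^ 2 := by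
    intro x
    rw [pstate, productState, norm_prod, Finset.prod_pow]
  simp only [normSq, this]
  rw [← Fintype.piFinset_univ, ← Finset.prod_univ_sum (fun _ : Fin n => (Finset.univ : Finset Bool))
    (fun i b => ‖q i (if b then 1 else 0)‖ ^ 2)]
  refine Finset.prod_eq_one fun i _ => ?_
  rw [Fintype.sum_bool, add_comm]
  simpa using hq i

/-! ### Rational functions with a sharp jump -/

/-- For `2 ^ (-ℓ) ≤ y ≤ 2` one of the powers `2 ^ (-i)`, `i ≤ ℓ`, lies between `y / 2` and `y`. -/
lemma exists_pow_le {ℓ : ℕ} {y : ℝ} (h : (1 / 2 : ℝ) ^ ℓ ≤ y) (h2 : y ≤ 2) :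
    ∃ i < ℓ + 1, (1 / 2 : ℝ) ^ i ≤ y ∧ y ≤ 2 * (1 / 2) ^ i := by
  induction ℓ with
  | zero => exact ⟨0, by omega, by simpa using h, by simpa using h2⟩
  | succ ℓ ih =>
    rcases le_total ((1 / 2 : ℝ) ^ ℓ) y with h' | h'
    · obtain ⟨i, hi, h3⟩ := ih h'
      exact ⟨i, by omega, h3⟩
    · refine ⟨ℓ + 1, by omega, h, ?_⟩
      rw [pow_succ]
      linarith

/-- For every `y` between `2 ^ (-ℓ)` and `2` one of the factors `y - 2 ^ (-i)` is small. -/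
lemma abs_prod_sub_le {ℓ : ℕ} {y : ℝ} (h : (1 / 2 : ℝ) ^ ℓ ≤ y) (h2 : y ≤ 2) :
    |∏ i ∈ Finset.range (ℓ + 1), (y - (1 / 2) ^ i)| ≤
      1 / 3 * ∏ i ∈ Finset.range (ℓ + 1), (y + (1 / 2) ^ i) := by
  obtain ⟨m, hm, h3, h4⟩ := exists_pow_le h h2
  have hy : 0 < y := lt_of_lt_of_le (by positivity) h
  have hm' : m ∈ Finset.range (ℓ + 1) := Finset.mem_range.2 hm
  rw [Finset.abs_prod, ← Finset.mul_prod_erase _ _ hm', ← Finset.mul_prod_erase _ _ hm',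
    ← mul_assoc]
  refine mul_le_mul ?_ (Finset.prod_le_prod (fun _ _ => abs_nonneg _) fun i _ => ?_)
    (Finset.prod_nonneg fun _ _ => abs_nonneg _) (by positivity)
  · rw [abs_of_nonneg (by linarith)]
    linarith
  · have : (0 : ℝ) < (1 / 2) ^ i := by positivity
    rw [abs_le]
    constructor <;> linarith

/-- The amplitude that stage `j` gives to the outcome `σ`. Here `x` is the difference between the
squared inner product and the threshold of the stage. -/
noncomputable def jump (n : ℕ) (x : ℝ) (σ : Bool) : ℝ :=
  (∏ i ∈ Finset.range n, (x - (if σ then -1 else 1) * (1 / 2) ^ i)) ^ n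

/-- Not both outcomes have amplitude `0`, so that no state vanishes after the postselections of a
stage. -/
lemma jump_ne_zero (n : ℕ) (x : ℝ) : jump n x true ≠ 0 ∨ jump n x false ≠ 0 := by
  rcases le_or_gt 0 x with h | h
  · left
    refine pow_ne_zero _ (Finset.prod_ne_zero_iff.2 fun i _ => ?_)
    have : (0 : ℝ) < (1 / 2) ^ i := by positivity
    simp only [if_true]
    linarith
  · right
    refine pow_ne_zero _ (Finset.prod_ne_zero_iff.2 fun i _ => ?_)
    have : (0 : ℝ) < (1 / 2) ^ i := by positivity
    simp only [Bool.false_eq_true, if_false]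
    linarith

/-- The probability that stage `j` has the outcome `σ`. -/
noncomputable def jumpProb (n : ℕ) (x : ℝ) (σ : Bool) : ℝ :=
  jump n x σ ^ 2 / (jump n x true ^ 2 + jump n x false ^ 2)

lemma jumpProb_nonneg (n : ℕ) (x : ℝ) (σ : Bool) : 0 ≤ jumpProb n x σ := by
  unfold jumpProb; positivity

lemma jump_sq_pos (n : ℕ) (x : ℝ) : 0 < jump n x true ^ 2 + jump n x false ^ 2 := by
  rcases jump_ne_zero n x with h | h
  · have := sq_pos_of_ne_zero h; positivity
  · have := sq_pos_of_ne_zero h; positivity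

lemma jumpProb_add (n : ℕ) (x : ℝ) : jumpProb n x true + jumpProb n x false = 1 := by
  rw [jumpProb, jumpProb, ← add_div, div_self (jump_sq_pos n x).ne']

lemma div_sq_le {a b c : ℝ} (hab : |a| ≤ c * b) (hb : 0 < a ^ 2 + b ^ 2) :
    a ^ 2 / (a ^ 2 + b ^ 2) ≤ c ^ 2 := by
  rw [div_le_iff₀ hb]
  have : a ^ 2 ≤ (c * b) ^ 2 := by
    rw [← sq_abs]
    gcongr
  nlinarith [mul_nonneg (sq_nonneg c) (sq_nonneg a)]

lemma third_pow_sq (n : ℕ) : ((1 / 3 : ℝ) ^ n) ^ 2 = (1 / 9) ^ n := by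
  rw [← pow_mul, mul_comm, pow_mul]; norm_num

lemma jumpProb_false_le {ℓ : ℕ} {x : ℝ} (h : (1 / 2 : ℝ) ^ ℓ ≤ x) (h2 : x ≤ 2) :
    jumpProb (ℓ + 1) x false ≤ (1 / 9) ^ (ℓ + 1) := by
  have hx : 0 < x := lt_of_lt_of_le (by positivity) h
  have key := abs_prod_sub_le h h2
  have e := jump_sq_pos (ℓ + 1) x
  rw [add_comm] at e
  rw [jumpProb, add_comm (jump _ x true ^ 2), ← third_pow_sq]
  refine div_sq_le ?_ e
  simp only [jump, if_true, Bool.false_eq_true, if_false, one_mul, neg_mul, sub_neg_eq_add]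
  rw [abs_pow, ← mul_pow]
  gcongr

lemma jumpProb_true_le {ℓ : ℕ} {x : ℝ} (h : x ≤ -(1 / 2 : ℝ) ^ ℓ) (h2 : -2 ≤ x) :
    jumpProb (ℓ + 1) x true ≤ (1 / 9) ^ (ℓ + 1) := by
  have hx : 0 < -x := lt_of_lt_of_le (by positivity) (le_neg_of_le_neg h)
  have key := abs_prod_sub_le (le_neg_of_le_neg h) (show -x ≤ 2 by linarith)
  have e := jump_sq_pos (ℓ + 1) x
  have e1 : |jump (ℓ + 1) x true| =
      |∏ i ∈ Finset.range (ℓ + 1), (-x - (1 / 2) ^ i)| ^ (ℓ + 1) := by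
    rw [jump, abs_pow, Finset.abs_prod, Finset.abs_prod]
    congr 1
    refine Finset.prod_congr rfl fun i _ => ?_
    rw [← abs_neg]
    congr 1
    simp
    ring
  have e2 : |jump (ℓ + 1) x false| =
      (∏ i ∈ Finset.range (ℓ + 1), (-x + (1 / 2) ^ i)) ^ (ℓ + 1) := by
    rw [jump, abs_pow, Finset.abs_prod]
    congr 1
    refine Finset.prod_congr rfl fun i _ => ?_
    rw [← abs_neg, abs_of_nonneg] <;> simp
    · ring
    · have : (0 : ℝ) < (2 ^ i)⁻¹ := by positivity
      linarith
  rw [jumpProb, ← third_pow_sq, ← sq_abs (jump (ℓ + 1) x false)]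
  rw [← sq_abs (jump (ℓ + 1) x false)] at e
  refine div_sq_le ?_ e
  rw [e1, e2, ← mul_pow]
  gcongr

/-! ### The circuits -/

/-- Stage `j` puts output qubit `j` into superposition and multiplies the amplitudes of its two
values by powers of `∏ i, (x ± 2⁻ⁱ)`. -/
def stage (D K B n j : ℕ) : List Op :=
  .had (D + 5 + j) :: (List.range n).flatMap fun r => (List.range n).flatMap fun i =>
    factor D K B j i (2 * ((j * n + r) * n + i)) (2 * ((j * n + r) * n + i) + 1)

/-- Puts the five work qubits into the state `|1⟩`. -/
def prepare (D : ℕ) : List Op := (List.range 5).flatMap fun i => [.had (D + i), .post (D + i)]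

/-- The measurement of qubit `i`, if there is one. -/
def measureGate (n i : ℕ) : List (Gate n) := if h : i < n then [.measure ⟨i, h⟩] else []

/-- Every stage and its measurement, for the stages `j, …, j + m - 1`. -/
def stages (W D K B n j m : ℕ) : List (Gate W) :=
  (List.range' j m).flatMap fun j => gatesOf W (stage D K B n j) ++ measureGate W (D + 5 + j)

/-- The circuit that computes `n` bits of the squared inner product, for numbers with `B` bits and
a sign. It uses `2 * n ^ 3` copies of the state. -/
def dotCircuit (n B : ℕ) : Circuit where
  width := 2 * n ^ 3 + 4 * (B + 1) + 5 + n
  gates := gatesOf _ (prepare (2 * n ^ 3 + 4 * (B + 1))) ++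
    stages _ (2 * n ^ 3 + 4 * (B + 1)) (2 * n ^ 3) B n 0 n
  outputs := (List.finRange n).map fun j : Fin n => ⟨2 * n ^ 3 + 4 * (B + 1) + 5 + (j : ℕ), by
    have := j.2; omega⟩

/-! ### The run of the circuits -/

/-- The qubits in the course of a run, when `c` pairs of copies of the state `γ` are used up and `o`
output qubits are set, to the values `v`. -/
noncomputable def config (K D : ℕ) (γ : Bool → ℝ) (desc v : ℕ → Bool) (o c a : ℕ) : Qubit :=
  if a < K then (if a < 2 * c then ket true else realKet γ)
  else if a < D then ket (desc (a - K))
  else if a < D + 5 then ket true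
  else if a < D + 5 + o then ket (v (a - (D + 5)))
  else ket false

section Config

variable {K D : ℕ} {γ : Bool → ℝ} {desc v : ℕ → Bool} {o c a : ℕ}

lemma config_spent (h : a < K) (h' : a < 2 * c) : config K D γ desc v o c a = ket true := by
  rw [config, if_pos h, if_pos h']

lemma config_copy (h : a < K) (h' : 2 * c ≤ a) : config K D γ desc v o c a = realKet γ := by
  rw [config, if_pos h, if_neg (by omega)]

lemma config_desc (h : K ≤ a) (h' : a < D) : config K D γ desc v o c a = ket (desc (a - K)) := by
  rw [config, if_neg (by omega), if_pos h']

lemma config_work (hK : K ≤ D) (h : D ≤ a) (h' : a < D + 5) :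
    config K D γ desc v o c a = ket true := by
  rw [config, if_neg (by omega), if_neg (by omega), if_pos h']

lemma config_output (hK : K ≤ D) (h : D + 5 ≤ a) (h' : a < D + 5 + o) :
    config K D γ desc v o c a = ket (v (a - (D + 5))) := by
  rw [config, if_neg (by omega), if_neg (by omega), if_neg (by omega), if_pos h']

lemma config_unset (hK : K ≤ D) (h : D + 5 + o ≤ a) : config K D γ desc v o c a = ket false := by
  rw [config, if_neg (by omega), if_neg (by omega), if_neg (by omega), if_neg (by omega)]

lemma config_rest (hK : K ≤ D) : Rest D (config K D γ desc v o c) :=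
  ⟨config_work hK (by omega) (by omega), config_work hK (by omega) (by omega),
    config_work hK (by omega) (by omega)⟩

lemma config_spend (hc : 2 * c + 1 < K) :
    Function.update (Function.update (config K D γ desc v o c) (2 * c) (ket true)) (2 * c + 1)
      (ket true) = config K D γ desc v o (c + 1) := by
  funext a
  rcases eq_or_ne a (2 * c + 1) with rfl | h1
  · rw [Function.update_self, config_spent hc (by omega)]
  · rw [Function.update_of_ne h1]
    rcases eq_or_ne a (2 * c) with rfl | h2
    · rw [Function.update_self, config_spent (by omega) (by omega)]
    · rw [Function.update_of_ne h2, config, config]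
      by_cases h : a < K
      · rw [if_pos h, if_pos h]
        by_cases h3 : a < 2 * c
        · rw [if_pos h3, if_pos (by omega)]
        · rw [if_neg h3, if_neg (by omega)]
      · rw [if_neg h, if_neg h]

lemma config_set (hK : K ≤ D) (σ : Bool) :
    Function.update (config K D γ desc v o c) (D + 5 + o) (ket σ) =
      config K D γ desc (Function.update v o σ) (o + 1) c := by
  funext a
  rcases eq_or_ne a (D + 5 + o) with rfl | h1
  · rw [Function.update_self, config_output hK (by omega) (by omega)]
    simp
  · rw [Function.update_of_ne h1]
    by_cases h : a < D + 5 + o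
    · by_cases h' : D + 5 ≤ a
      · rw [config_output hK h' h, config_output hK h' (by omega), Function.update_of_ne (by omega)]
      · simp only [config, show a < D + 5 by omega, if_true]
    · rw [config_unset hK (by omega), config_unset hK (by omega)]

lemma ket_norm (b : Bool) : ‖ket b 0‖ ^ 2 + ‖ket b 1‖ ^ 2 = 1 := by
  cases b <;> simp [ket]

lemma realKet_eq (γ : Bool → ℝ) : realKet γ = !₂[(γ false : ℂ), (γ true : ℂ)] := by
  ext i
  fin_cases i <;> simp [realKet, ket]

lemma normSq_config {n : ℕ} (hγ : γ false ^ 2 + γ true ^ 2 = 1) :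
    normSq (pstate n (config K D γ desc v o c)) = 1 := by
  refine normSq_pstate fun a => ?_
  rw [config]
  split_ifs
  · exact ket_norm _
  · rw [realKet_eq]
    simpa using hγ
  · exact ket_norm _
  · exact ket_norm _
  · exact ket_norm _
  · exact ket_norm _

end Config

lemma run_loop {n m : ℕ} {F : ℕ → List Op} {Q : ℕ → State n} {a : ℕ → ℝ}
    (h : ∀ i < m, run n (F i) (Q i) = a i • Q (i + 1)) :
    run n ((List.range m).flatMap F) (Q 0) = (∏ i ∈ Finset.range m, a i) • Q m := by
  induction m with
  | zero => simp
  | succ m ih =>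
    rw [List.range_succ, List.flatMap_append, run_append, ih fun i hi => h i (by omega), run_smul,
      List.flatMap_singleton, h m (by omega), smul_smul, Finset.prod_range_succ]

lemma run_factor_config {n D K B j c : ℕ} (i : ℕ) (hD : D = K + 4 * (B + 1)) (hn : D + 5 + j < n)
    (hc : 2 * c + 1 < K) (γ : Bool → ℝ) (desc : ℕ → Bool) :
    ∃ C : ℝ, C ≠ 0 ∧ ∀ v : ℕ → Bool,
      run n (factor D K B j i (2 * c) (2 * c + 1)) (pstate n (config K D γ desc v (j + 1) c)) =
        (C * (∑ c, (∑ κ, γ κ * descNumber 0 B desc c κ) ^ 2 -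
          2 ^ B * (∑ κ, γ κ ^ 2) * (threshold v j + (if v j then -1 else 1) * (1 / 2) ^ i))) •
        pstate n (config K D γ desc v (j + 1) (c + 1)) := by
  obtain ⟨C, hC, h⟩ := run_factor i hD hn (show 2 * c < K by omega) hc (by omega)
  refine ⟨C, hC, fun v => ?_⟩
  have hK : K ≤ D := by omega
  rw [h _ (fun a => if a < D then desc (a - K) else v (a - (D + 5))) γ (config_rest hK)
    (config_work hK (by omega) (by omega)) (config_work hK (by omega) (by omega))
    (config_copy (by omega) (by omega)) (config_copy (by omega) (by omega)), config_spend hc]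
  · have e1 : ∀ c κ r, r ≤ B → descQubit K B c κ r < D ∧
        descQubit K B c κ r - K = descQubit 0 B c κ r := by
      intro c κ r hr
      refine ⟨(descQubit_mem hD c κ hr).2, ?_⟩
      simp only [descQubit]
      omega
    have e2 : ∀ c κ, descNumber K B (fun a => if a < D then desc (a - K) else v (a - (D + 5))) c κ =
        descNumber 0 B desc c κ := by
      intro c κ
      simp only [descNumber, (e1 c κ B le_rfl).1, (e1 c κ B le_rfl).2, if_true]
      congr 1
      refine Finset.sum_congr rfl fun r hr => ?_
      have := e1 c κ r (Finset.mem_range.1 hr).le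
      simp only [this.1, this.2, if_true]
    have e3 : ∀ s, ¬ D + 5 + s < D := by omega
    simp only [e2, e3, if_false, Nat.add_sub_cancel_left]
  · rintro a (⟨h1, h2⟩ | ⟨h1, h2⟩)
    · rw [config_desc h1 h2, if_pos h2]
    · rw [config_output hK h1 (by omega), if_neg (by omega)]

lemma binaryValue_update_self (v : ℕ → Bool) (j : ℕ) (σ : Bool) :
    binaryValue (Function.update v j σ) j = binaryValue v j := by
  refine Finset.sum_congr rfl fun s hs => ?_
  rw [Function.update_of_ne (Finset.mem_range.1 hs).ne]

lemma threshold_update (v : ℕ → Bool) (j : ℕ) (σ : Bool) :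
    threshold (Function.update v j σ) j = threshold v j := by
  rw [threshold, binaryValue_update_self, threshold]

/-- The index of a pair of copies is in range. -/
lemma copy_index_lt {n j r i : ℕ} (hj : j < n) (hr : r < n) (hi : i < n) :
    2 * ((j * n + r) * n + i) + 1 < 2 * n ^ 3 := by
  have h1 : j * n + r + 1 ≤ n * n := by nlinarith
  have h2 : (j * n + r + 1) * n ≤ n * n * n := Nat.mul_le_mul_right _ h1
  have h3 : n ^ 3 = n * n * n := by ring
  have h4 : (j * n + r + 1) * n = (j * n + r) * n + n := by ring
  omega

/-- Stage `j` splits the state into the two values of output qubit `j`, with amplitudes that jump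
where `p` passes the threshold. -/
lemma run_stage {W n D K B j : ℕ} (hK : K = 2 * n ^ 3) (hD : D = K + 4 * (B + 1))
    (hW : D + 5 + n ≤ W) (hj : j < n) {γ : Bool → ℝ} {desc : ℕ → Bool} {p : ℝ}
    (hγ : ∑ κ, γ κ ^ 2 = 1) (hp : ∑ c, (∑ κ, γ κ * descNumber 0 B desc c κ) ^ 2 = 2 ^ B * p) :
    ∃ C : ℝ, C ≠ 0 ∧ ∀ v : ℕ → Bool,
      run W (stage D K B n j) (pstate W (config K D γ desc v j (j * n * n))) =
        ∑ σ, (C * jump n (p - threshold v j) σ) •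
          pstate W (config K D γ desc (Function.update v j σ) (j + 1) ((j + 1) * n * n)) := by
  have hf : ∀ r i, ∃ C : ℝ, C ≠ 0 ∧ (r < n → i < n → ∀ v : ℕ → Bool,
      run W (factor D K B j i (2 * ((j * n + r) * n + i)) (2 * ((j * n + r) * n + i) + 1))
        (pstate W (config K D γ desc v (j + 1) ((j * n + r) * n + i))) =
      (C * (p - threshold v j - (if v j then -1 else 1) * (1 / 2) ^ i)) •
        pstate W (config K D γ desc v (j + 1) ((j * n + r) * n + i + 1))) := by
    intro r i
    by_cases h : r < n ∧ i < n
    · obtain ⟨C, hC, hrun⟩ := run_factor_config (n := W) (j := j) i hD (by omega)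
        (hK ▸ copy_index_lt hj h.1 h.2) γ desc
      refine ⟨C * 2 ^ B, by positivity, fun _ _ v => ?_⟩
      rw [hrun v, hp, hγ]
      congr 1
      ring
    · exact ⟨1, one_ne_zero, fun h1 h2 => absurd ⟨h1, h2⟩ h⟩
  choose c hc hf using hf
  refine ⟨(√2)⁻¹ * ∏ r ∈ Finset.range n, ∏ i ∈ Finset.range n, c r i, ?_, fun v => ?_⟩
  · exact mul_ne_zero (by positivity)
      (Finset.prod_ne_zero_iff.2 fun r _ => Finset.prod_ne_zero_iff.2 fun i _ => hc r i)
  have hKD : K ≤ D := by omega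
  have loop : ∀ v' : ℕ → Bool,
      run W ((List.range n).flatMap fun r => (List.range n).flatMap fun i =>
        factor D K B j i (2 * ((j * n + r) * n + i)) (2 * ((j * n + r) * n + i) + 1))
        (pstate W (config K D γ desc v' (j + 1) (j * n * n))) =
      ((∏ r ∈ Finset.range n, ∏ i ∈ Finset.range n, c r i) *
        jump n (p - threshold v' j) (v' j)) •
        pstate W (config K D γ desc v' (j + 1) ((j + 1) * n * n)) := by
    intro v'
    have h1 := run_loop (m := n) (n := W)
      (Q := fun r => pstate W (config K D γ desc v' (j + 1) ((j * n + r) * n)))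
      (F := fun r => (List.range n).flatMap fun i =>
        factor D K B j i (2 * ((j * n + r) * n + i)) (2 * ((j * n + r) * n + i) + 1))
      (a := fun r => ∏ i ∈ Finset.range n,
        c r i * (p - threshold v' j - (if v' j then -1 else 1) * (1 / 2) ^ i))
      (fun r hr => by
        have h2 := run_loop (m := n) (n := W)
          (Q := fun i => pstate W (config K D γ desc v' (j + 1) ((j * n + r) * n + i)))
          (F := fun i => factor D K B j i (2 * ((j * n + r) * n + i))
            (2 * ((j * n + r) * n + i) + 1))
          (a := fun i => c r i * (p - threshold v' j - (if v' j then -1 else 1) * (1 / 2) ^ i))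
          (fun i hi => hf r i hr hi v')
        rw [show (j * n + (r + 1)) * n = (j * n + r) * n + n by ring]
        exact h2)
    rw [show (j + 1) * n * n = (j * n + n) * n by ring]
    simp only [add_zero] at h1
    rw [h1]
    congr 1
    simp only [Finset.prod_mul_distrib, jump, Finset.prod_const, Finset.card_range]
  rw [stage, run_cons, pstate_had (by omega) (config_unset (v := v) hKD le_rfl), run_smul, run_add,
    run_smul, config_set hKD, config_set hKD, loop, loop]
  simp only [threshold_update, Function.update_self, Fintype.sum_bool, Bool.false_eq_true, if_false]
  module

lemma project_pstate {n : ℕ} {q : ℕ → Qubit} (i : Fin n) {τ : Bool} (hq : q i = ket τ) (r : Bool) :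
    project i r (pstate n q) = (if τ = r then 1 else 0 : ℝ) • pstate n q := by
  funext x
  rw [project, Pi.smul_apply, pstate_apply q i]
  simp only [hq, ket_apply]
  cases τ <;> cases r <;> cases x i <;> simp

lemma outcomeProb_stages_succ {W n D K B j m : ℕ} (hK : K = 2 * n ^ 3) (hD : D = K + 4 * (B + 1))
    (hW : D + 5 + n ≤ W) (hj : j < n) {γ : Bool → ℝ} {desc : ℕ → Bool} {p : ℝ}
    (hγ : ∑ κ, γ κ ^ 2 = 1) (hp : ∑ c, (∑ κ, γ κ * descNumber 0 B desc c κ) ^ 2 = 2 ^ B * p)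
    (v : ℕ → Bool) (E : Set (Fin W → Bool)) :
    outcomeProb (stages W D K B n j (m + 1)) (pstate W (config K D γ desc v j (j * n * n))) E =
      ∑ σ, jumpProb n (p - threshold v j) σ *
        outcomeProb (stages W D K B n (j + 1) m) (pstate W
          (config K D γ desc (Function.update v j σ) (j + 1) ((j + 1) * n * n))) E := by
  obtain ⟨C, hC, hrun⟩ := run_stage hK hD hW hj hγ hp
  have hi : D + 5 + j < W := by omega
  have hKD : K ≤ D := by omega
  rw [stages, List.range'_succ, List.flatMap_cons, List.append_assoc, outcomeProb_gatesOf, hrun,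
    measureGate, dif_pos hi, List.singleton_append, outcomeProb_measure _ _ _ _
      (fun σ => C * jump n (p - threshold v j) σ) _ _ fun σ => normSq_config
        (v := Function.update v j σ) (n := W) (K := K) (D := D) (desc := desc) (o := j + 1)
        (c := (j + 1) * n * n) (by simpa [add_comm] using hγ)]
  · refine Finset.sum_congr rfl fun σ _ => ?_
    rw [jumpProb, mul_pow, mul_pow, mul_pow, ← mul_add,
      mul_div_mul_left _ _ (pow_ne_zero 2 hC)]
    rfl
  · intro r
    have e : ∀ σ, project ⟨D + 5 + j, hi⟩ r (pstate W
        (config K D γ desc (Function.update v j σ) (j + 1) ((j + 1) * n * n))) =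
        (if σ = r then 1 else 0 : ℝ) • pstate W
        (config K D γ desc (Function.update v j σ) (j + 1) ((j + 1) * n * n)) := fun σ =>
      project_pstate _ (by rw [config_output hKD (by simp) (by simp)]; simp) r
    have add : ∀ φ χ : State W, project ⟨D + 5 + j, hi⟩ r (φ + χ) =
        project ⟨D + 5 + j, hi⟩ r φ + project ⟨D + 5 + j, hi⟩ r χ := by
      intro φ χ
      funext x
      simp only [project, Pi.add_apply]
      split_ifs <;> simp
    simp only [Fintype.sum_bool, add, project_smul, e]
    cases r <;> simp

/-- If in every stage at most one outcome leads out of the good histories `P`, and with probability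
at most `δ`, then a good history leads to the event `E` but for probability `δ` per stage. -/
lemma le_outcomeProb_stages {W n D K B : ℕ} (hK : K = 2 * n ^ 3) (hD : D = K + 4 * (B + 1))
    (hW : D + 5 + n ≤ W) {γ : Bool → ℝ} {desc : ℕ → Bool} {p : ℝ}
    (hγ : ∑ κ, γ κ ^ 2 = 1) (hp : ∑ c, (∑ κ, γ κ * descNumber 0 B desc c κ) ^ 2 = 2 ^ B * p)
    (E : Set (Fin W → Bool)) (P : ℕ → (ℕ → Bool) → Prop) {δ : ℝ} (hδ : 0 ≤ δ)
    (step : ∀ j < n, ∀ v, P j v → (∀ σ, P (j + 1) (Function.update v j σ)) ∨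
      ∃ σ, P (j + 1) (Function.update v j σ) ∧ jumpProb n (p - threshold v j) (!σ) ≤ δ)
    (final : ∀ v, P n v → ∀ x : Fin W → Bool,
      (∀ s (hs : s < n), x ⟨D + 5 + s, by omega⟩ = v s) → x ∈ E)
    (m j : ℕ) (hm : j + m = n) (v : ℕ → Bool) (hv : P j v) :
    1 - m * δ ≤
      outcomeProb (stages W D K B n j m) (pstate W (config K D γ desc v j (j * n * n))) E := by
  have hKD : K ≤ D := by omega
  induction m generalizing j v with
  | zero =>
    obtain rfl : j = n := by omega
    set φ := pstate W (config K D γ desc v j (j * j * j)) with hφ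
    have h1 : normSq φ = 1 := normSq_config (by simpa [add_comm] using hγ)
    have h2 : E.indicator φ = φ := by
      refine Set.indicator_eq_self.2 fun x hx => final v hv x fun s hs => ?_
      by_contra hne
      refine hx ?_
      rw [hφ, pstate_apply _ ⟨D + 5 + s, by omega⟩]
      simp only
      rw [config_output hKD (by omega) (by omega), Nat.add_sub_cancel_left, ket_apply, if_neg hne,
        zero_mul]
    simp [stages, outcomeProb, h2, h1]
  | succ m ih =>
    rw [outcomeProb_stages_succ hK hD hW (by omega) hγ hp]
    have hsum := jumpProb_add n (p - threshold v j)
    have hnn := jumpProb_nonneg n (p - threshold v j)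
    set O := fun σ => outcomeProb (stages W D K B n (j + 1) m) (pstate W
      (config K D γ desc (Function.update v j σ) (j + 1) ((j + 1) * n * n))) E with hO
    have hO0 : ∀ σ, 0 ≤ O σ := fun σ => (outcomeProb_mem_Icc _ _ _).1
    have hP : ∀ σ, P (j + 1) (Function.update v j σ) → 1 - m * δ ≤ O σ := fun σ h =>
      ih (j + 1) (by omega) _ h
    have hmδ : 0 ≤ m * δ := by positivity
    rw [Fintype.sum_bool]
    push_cast
    change _ ≤ jumpProb n (p - threshold v j) true * O true +
      jumpProb n (p - threshold v j) false * O false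
    rcases step j (by omega) v hv with h | ⟨σ, h, h'⟩
    · have h1 := mul_le_mul_of_nonneg_left (hP true (h true)) (hnn true)
      have h0 := mul_le_mul_of_nonneg_left (hP false (h false)) (hnn false)
      nlinarith
    · have h1 := mul_le_mul_of_nonneg_left (hP σ h) (hnn σ)
      have h0 := mul_nonneg (hnn (!σ)) (hO0 (!σ))
      have h2 := mul_nonneg hmδ (hnn (!σ))
      cases σ <;> simp only [Bool.not_true, Bool.not_false] at * <;> nlinarith

/-- The preparation of the input. Bits of the description beyond its end are unset: they are the
ancillas. -/
lemma run_prepare {W D K : ℕ} (hW : D + 5 ≤ W) (hKD : K ≤ D) (γ : Bool → ℝ) (desc : ℕ → Bool)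
    (hdesc : ∀ a, D - K ≤ a → desc a = false) (v : ℕ → Bool) :
    ∃ C : ℝ, C ≠ 0 ∧ run W (prepare D)
      (pstate W fun a => if a < K then realKet γ else ket (desc (a - K))) =
        C • pstate W (config K D γ desc v 0 0) := by
  refine ⟨∏ _i ∈ Finset.range 5, (√2)⁻¹, by positivity, ?_⟩
  have h := run_loop (n := W) (m := 5) (F := fun i => [.had (D + i), .post (D + i)])
    (Q := fun i => pstate W fun a => if D ≤ a ∧ a < D + i then ket true else
      if a < K then realKet γ else ket (desc (a - K))) (a := fun _ => (√2)⁻¹) (fun i hi => by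
        rw [run_had_post (τ := false) (by omega) (by
          rw [if_neg (by omega), if_neg (by omega), hdesc _ (by omega)])]
        simp only [Bool.false_eq_true, if_false, mul_one]
        congr 2
        funext a
        rcases eq_or_ne a (D + i) with rfl | h
        · simp
        · rw [Function.update_of_ne h]
          congr 1
          simp only [eq_iff_iff]
          omega)
  have e0 : (fun a => if a < K then realKet γ else ket (desc (a - K))) = fun a =>
      if D ≤ a ∧ a < D + 0 then ket true else
        if a < K then realKet γ else ket (desc (a - K)) := by
    funext a
    rw [if_neg (c := D ≤ a ∧ a < D + 0) (by omega)]
  have e5 : config K D γ desc v 0 0 = fun a => if D ≤ a ∧ a < D + 5 then ket true else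
        if a < K then realKet γ else ket (desc (a - K)) := by
    funext a
    by_cases h1 : a < K
    · rw [config_copy h1 (by omega), if_neg (by omega), if_pos h1]
    · by_cases h2 : a < D
      · rw [config_desc (by omega) h2, if_neg (by omega), if_neg h1]
      · by_cases h3 : a < D + 5
        · rw [config_work hKD (by omega) h3, if_pos (by omega)]
        · rw [config_unset hKD (by omega), if_neg (by omega), if_neg h1, hdesc _ (by omega)]
  rw [prepare, e0, e5]
  exact h

/-! ### Uniformity -/

namespace OpsWritable

variable {n : ℕ} {D K B j i k k₁ k₂ c e : (Fin n → ℕ) → ℕ}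

lemma onBit (hD : Expressible D) (hc : Expressible c) :
    OpsWritable fun ρ => onBit (D ρ) (c ρ) :=
  tof (hD.add (.const 3)) hD (hD.add (.const 1)) <|
    tof (hD.add (.const 3)) hc (hD.add (.const 1)) <| post (hD.add (.const 1)) nil

lemma offBit (hD : Expressible D) (hc : Expressible c) :
    OpsWritable fun ρ => offBit (D ρ) (c ρ) :=
  tof (hD.add (.const 3)) hc (hD.add (.const 1)) <| post (hD.add (.const 1)) nil

lemma signBit (hD : Expressible D) (hc : Expressible c) :
    OpsWritable fun ρ => signBit (D ρ) (c ρ) :=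
  had (hD.add (.const 2)) <| tof (hD.add (.const 3)) hc (hD.add (.const 2)) <|
    had (hD.add (.const 2)) nil

lemma halve (hD : Expressible D) : OpsWritable fun ρ => halve (D ρ) :=
  had (hD.add (.const 2)) <| tof (hD.add (.const 2)) (hD.add (.const 3)) (hD.add (.const 1)) <|
    post (hD.add (.const 1)) <| had (hD.add (.const 2)) <| post (hD.add (.const 2)) nil

lemma double (hD : Expressible D) : OpsWritable fun ρ => double (D ρ) :=
  had (hD.add (.const 2)) <| tof (hD.add (.const 2)) hD (hD.add (.const 1)) <|
    tof (hD.add (.const 2)) (hD.add (.const 3)) (hD.add (.const 1)) <|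
    post (hD.add (.const 1)) <| had (hD.add (.const 2)) <| post (hD.add (.const 2)) nil

lemma selectBit (hD : Expressible D) (hk : Expressible k) (κ : Bool) :
    OpsWritable fun ρ => selectBit (D ρ) (k ρ) κ := by
  cases κ
  · exact offBit hD hk
  · exact onBit hD hk

lemma repeat_double (he : Expressible e) (hD : Expressible D) :
    OpsWritable fun ρ => repeated (e ρ) (PostBQP.double (D ρ)) :=
  flatMap_range (f := fun ρ _ => PostBQP.double (D ρ)) he (double hD.init)

lemma repeat_halve (he : Expressible e) (hD : Expressible D) :
    OpsWritable fun ρ => repeated (e ρ) (PostBQP.halve (D ρ)) :=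
  flatMap_range (f := fun ρ _ => PostBQP.halve (D ρ)) he (halve hD.init)

lemma flatMap_bool {F : (Fin n → ℕ) → Bool → List Op} (h : ∀ b, OpsWritable fun ρ => F ρ b) :
    OpsWritable fun ρ => [false, true].flatMap (F ρ) := by
  simpa using (h false).append (h true)

lemma addTerm {G : (Fin n → ℕ) → List Op} (hD : Expressible D) (hG : OpsWritable G) :
    OpsWritable fun ρ => addTerm (D ρ) (G ρ) :=
  had (hD.add (.const 3)) <| hG.append <|
    tof (hD.add (.const 3)) (hD.add (.const 4)) (hD.add (.const 1)) <| post (hD.add (.const 1)) <|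
    tof (hD.add (.const 3)) hD (hD.add (.const 4)) <| had (hD.add (.const 3)) <|
    post (hD.add (.const 3)) nil

lemma _root_.PostBQP.Expressible.descQubit (hK : Expressible K) (hB : Expressible B) (a κ : Bool)
    (hc : Expressible c) : Expressible fun ρ => descQubit (K ρ) (B ρ) a κ (c ρ) :=
  (hK.add ((Expressible.const _).mul (hB.add (.const 1)))).add hc

lemma addProducts (hD : Expressible D) (hK : Expressible K) (hB : Expressible B)
    (h₁ : Expressible k₁) (h₂ : Expressible k₂) :
    OpsWritable fun ρ => addProducts (D ρ) (K ρ) (B ρ) (k₁ ρ) (k₂ ρ) := by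
  refine flatMap_bool fun a => flatMap_bool fun κ₁ => flatMap_bool fun κ₂ => ?_
  refine flatMap_range hB (flatMap_range hB.init ?_)
  have hr₁ : Expressible fun ρ : Fin (n + 2) → ℕ => Fin.init ρ (Fin.last n) :=
    (Expressible.proj (Fin.last n)).init
  have hr₂ : Expressible fun ρ : Fin (n + 2) → ℕ => ρ (Fin.last (n + 1)) :=
    Expressible.proj (Fin.last (n + 1))
  have hD := hD.init.init
  have hK := hK.init.init
  have hB := hB.init.init
  exact addTerm hD <| (((((((selectBit hD h₁.init.init κ₁).append
    (selectBit hD h₂.init.init κ₂)).append (onBit hD (hK.descQubit hB a κ₁ hr₁))).append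
    (onBit hD (hK.descQubit hB a κ₂ hr₂))).append (signBit hD (hK.descQubit hB a κ₁ hB))).append
    (signBit hD (hK.descQubit hB a κ₂ hB))).append (repeat_double hr₁ hD)).append
    (repeat_double hr₂ hD)

lemma diagonalWeight (hD : Expressible D) (hB : Expressible B) (h₁ : Expressible k₁)
    (h₂ : Expressible k₂) (κ : Bool) {G : (Fin n → ℕ) → List Op} (hG : OpsWritable G)
    (he : Expressible e) :
    OpsWritable fun ρ => diagonalWeight (D ρ) (B ρ) (k₁ ρ) (k₂ ρ) κ (G ρ) (e ρ) :=
  (((((selectBit hD h₁ κ).append (selectBit hD h₂ κ)).append (signBit hD hD)).append hG).append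
    (repeat_double hB hD)).append (repeat_halve he hD)

lemma addThreshold (hD : Expressible D) (hB : Expressible B) (hj : Expressible j)
    (hi : Expressible i) (h₁ : Expressible k₁) (h₂ : Expressible k₂) :
    OpsWritable fun ρ => addThreshold (D ρ) (B ρ) (j ρ) (i ρ) (k₁ ρ) (k₂ ρ) := by
  refine flatMap_bool fun κ => ?_
  have hs : Expressible fun ρ : Fin (n + 1) → ℕ => ρ (Fin.last n) := Expressible.proj (Fin.last n)
  refine (flatMap_range hj ?_).append ((addTerm hD
    (diagonalWeight hD hB h₁ h₂ κ nil (hj.add (.const 1)))).append (addTerm hD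
      (diagonalWeight hD hB h₁ h₂ κ (signBit hD ((hD.add (.const 5)).add hj)) hi)))
  exact addTerm hD.init (diagonalWeight hD.init hB.init h₁.init h₂.init κ
    (onBit hD.init ((hD.init.add (.const 5)).add hs)) (hs.add (.const 1)))

lemma merge (hD : Expressible D) (hk : Expressible k) : OpsWritable fun ρ => merge (D ρ) (k ρ) :=
  had hk <| tof hD (hD.add (.const 2)) hk <| post hk nil

lemma factor (hD : Expressible D) (hK : Expressible K) (hB : Expressible B) (hj : Expressible j)
    (hi : Expressible i) (h₁ : Expressible k₁) (h₂ : Expressible k₂) :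
    OpsWritable fun ρ => factor (D ρ) (K ρ) (B ρ) (j ρ) (i ρ) (k₁ ρ) (k₂ ρ) :=
  tof hD (hD.add (.const 2)) (hD.add (.const 4)) <|
    ((addProducts hD hK hB h₁ h₂).append (addThreshold hD hB hj hi h₁ h₂)).append <|
    post (hD.add (.const 4)) <| (merge hD h₁).append (merge hD h₂)

lemma stage {m : (Fin n → ℕ) → ℕ} (hD : Expressible D) (hK : Expressible K) (hB : Expressible B)
    (hm : Expressible m) (hj : Expressible j) :
    OpsWritable fun ρ => stage (D ρ) (K ρ) (B ρ) (m ρ) (j ρ) := by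
  refine had ((hD.add (.const 5)).add hj) (flatMap_range hm (flatMap_range hm.init ?_))
  have hr : Expressible fun ρ : Fin (n + 2) → ℕ => Fin.init ρ (Fin.last n) :=
    (Expressible.proj (Fin.last n)).init
  have hi : Expressible fun ρ : Fin (n + 2) → ℕ => ρ (Fin.last (n + 1)) :=
    Expressible.proj (Fin.last (n + 1))
  have hm := hm.init.init
  have hj := hj.init.init
  have hc := (Expressible.const 2).mul ((((hj.mul hm).add hr).mul hm).add hi)
  exact factor hD.init.init hK.init.init hB.init.init hj hi hc (hc.add (.const 1))

end OpsWritable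

lemma allValid_selectBit {W D k : ℕ} (hW : D + 5 ≤ W) (hk : k < W) (hk' : k < D ∨ D + 5 ≤ k)
    (κ : Bool) : AllValid W (selectBit D k κ) := by
  cases κ <;> simp [AllValid, selectBit, onBit, offBit, Op.Valid] <;> omega

lemma allValid_onBit {W D k : ℕ} (hW : D + 5 ≤ W) (hk : k < W) (hk' : k < D ∨ D + 5 ≤ k) :
    AllValid W (onBit D k) := allValid_selectBit hW hk hk' true

lemma allValid_signBit {W D k : ℕ} (hW : D + 5 ≤ W) (hk : k < W) (hk' : k ≤ D ∨ D + 5 ≤ k) :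
    AllValid W (signBit D k) := by
  simp [AllValid, signBit, Op.Valid]; omega

lemma allValid_repeated {W : ℕ} {G : List Op} (hG : AllValid W G) (e : ℕ) :
    AllValid W (repeated e G) := .flatMap fun _ _ => hG

lemma allValid_double {W D : ℕ} (hW : D + 5 ≤ W) : AllValid W (double D) := by
  simp [AllValid, double, Op.Valid]; omega

lemma allValid_halve {W D : ℕ} (hW : D + 5 ≤ W) : AllValid W (halve D) := by
  simp [AllValid, halve, Op.Valid]; omega

lemma allValid_addTerm {W D : ℕ} (hW : D + 5 ≤ W) {G : List Op} (hG : AllValid W G) :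
    AllValid W (addTerm D G) := by
  refine .cons (show D + 3 < W by omega) (hG.append ?_)
  simp [AllValid, Op.Valid]; omega

lemma allValid_addProducts {W D K B k₁ k₂ : ℕ} (hD : D = K + 4 * (B + 1)) (hW : D + 5 ≤ W)
    (h₁ : k₁ < K) (h₂ : k₂ < K) : AllValid W (addProducts D K B k₁ k₂) := by
  refine .flatMap fun c _ => .flatMap fun κ₁ _ => .flatMap fun κ₂ _ => .flatMap fun r₁ hr₁ =>
    .flatMap fun r₂ hr₂ => allValid_addTerm hW ?_
  have d := fun κ r hr => (descQubit_mem (r := r) hD c κ hr).2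
  have d1 := d κ₁ r₁ (List.mem_range.1 hr₁).le
  have d2 := d κ₂ r₂ (List.mem_range.1 hr₂).le
  have d3 := d κ₁ B le_rfl
  have d4 := d κ₂ B le_rfl
  exact (((((((allValid_selectBit hW (by omega) (by omega) κ₁).append
    (allValid_selectBit hW (by omega) (by omega) κ₂)).append
    (allValid_onBit hW (by omega) (by omega))).append
    (allValid_onBit hW (by omega) (by omega))).append
    (allValid_signBit hW (by omega) (by omega))).append
    (allValid_signBit hW (by omega) (by omega))).append
    (allValid_repeated (allValid_double hW) _)).append (allValid_repeated (allValid_double hW) _)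

lemma allValid_diagonalWeight {W D B k₁ k₂ : ℕ} (hW : D + 5 ≤ W)
    (h₁ : k₁ < D) (h₂ : k₂ < D) (κ : Bool) {G : List Op} (hG : AllValid W G) (e : ℕ) :
    AllValid W (diagonalWeight D B k₁ k₂ κ G e) :=
  (((((allValid_selectBit hW (by omega) (by omega) κ).append
    (allValid_selectBit hW (by omega) (by omega) κ)).append
    (allValid_signBit hW (by omega) (by omega))).append hG).append
    (allValid_repeated (allValid_double hW) _)).append (allValid_repeated (allValid_halve hW) _)

lemma allValid_addThreshold {W D B j i k₁ k₂ : ℕ} (hW : D + 5 + j < W)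
    (h₁ : k₁ < D) (h₂ : k₂ < D) : AllValid W (addThreshold D B j i k₁ k₂) := by
  have hW' : D + 5 ≤ W := by omega
  refine .flatMap fun κ _ => .append (.flatMap fun s hs => ?_) (.append ?_ ?_)
  · have := List.mem_range.1 hs
    exact allValid_addTerm hW' (allValid_diagonalWeight hW' h₁ h₂ κ
      (allValid_onBit hW' (by omega) (by omega)) _)
  · exact allValid_addTerm hW' (allValid_diagonalWeight hW' h₁ h₂ κ .nil _)
  · exact allValid_addTerm hW' (allValid_diagonalWeight hW' h₁ h₂ κ
      (allValid_signBit hW' (by omega) (by omega)) _)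

lemma allValid_stage {W D K B n j : ℕ} (hK : K = 2 * n ^ 3) (hD : D = K + 4 * (B + 1))
    (hW : D + 5 + n ≤ W) (hj : j < n) : AllValid W (stage D K B n j) := by
  refine .cons (show D + 5 + j < W by omega) (.flatMap fun r hr => .flatMap fun i hi => ?_)
  have hc := copy_index_lt hj (List.mem_range.1 hr) (List.mem_range.1 hi)
  rw [← hK] at hc
  generalize 2 * ((j * n + r) * n + i) = k at hc ⊢
  have hm : ∀ k < D, AllValid W (merge D k) := by
    intro k hk
    simp [AllValid, merge, Op.Valid]; omega
  refine .cons (by simp only [Op.Valid]; omega) (((allValid_addProducts hD (by omega) (by omega)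
    hc).append (allValid_addThreshold (by omega) (by omega) (by omega))).append
    (.cons (show D + 4 < W by omega) ((hm _ (by omega)).append (hm _ (by omega)))))

lemma allValid_prepare {W D : ℕ} (hW : D + 5 ≤ W) : AllValid W (prepare D) :=
  .flatMap fun i hi => by
    have := List.mem_range.1 hi
    simp [AllValid, Op.Valid]; omega

/-- In the definition of the description the list of output qubits is cast to numbers first. -/
lemma Circuit.encode_eq (C : Circuit) : C.encode = ticks C.width ++ (C.gates.flatMap Gate.encode ++
    C.outputs.flatMap fun i : Fin C.width => Symbol.output :: ticks i) := by
  simp [Circuit.encode, List.bind_eq_flatMap, List.pure_def, List.flatMap_assoc]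

lemma encode_dotCircuit (n B : ℕ) : (dotCircuit n B).encode =
    ticks (2 * n ^ 3 + 4 * (B + 1) + 5 + n) ++
      (((prepare (2 * n ^ 3 + 4 * (B + 1))).flatMap Op.encode ++
        (List.range n).flatMap fun j =>
          (stage (2 * n ^ 3 + 4 * (B + 1)) (2 * n ^ 3) B n j).flatMap Op.encode ++
            .measure :: ticks (2 * n ^ 3 + 4 * (B + 1) + 5 + j)) ++
        (List.range n).flatMap fun j =>
          .output :: ticks (2 * n ^ 3 + 4 * (B + 1) + 5 + j)) := by
  rw [Circuit.encode_eq, dotCircuit]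
  simp only
  congr 2
  · rw [List.flatMap_append, encode_gatesOf (allValid_prepare (by omega)), stages,
      List.flatMap_assoc, ← List.range_eq_range']
    congr 1
    refine List.flatMap_congr fun j hj => ?_
    have hj := List.mem_range.1 hj
    rw [List.flatMap_append, encode_gatesOf (allValid_stage rfl rfl le_rfl hj), measureGate,
      dif_pos (by omega)]
    simp [Gate.encode]
  · rw [List.flatMap_map, ← List.map_coe_finRange_eq_range, List.flatMap_map]

/-- A circuit family whose description is written by a generator is uniform; the length of the
description bounds the size. -/
lemma isUniformFamily_of_writable {C : ℕ → Circuit}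
    (h : Writable fun ρ : Fin 1 → ℕ => (C (ρ 0)).encode) : IsUniformFamily C := by
  refine ⟨?_, h.computable⟩
  obtain ⟨g, hg⟩ := h
  refine ⟨g.lengthBound, fun ℓ => ?_⟩
  have hlen := g.length_eval_le (ρ := fun _ => ℓ) (N := ℓ) fun _ => le_rfl
  rw [hg] at hlen
  have key : ∀ {α : Type} (l : List α) (f : α → List Symbol), (∀ x, 1 ≤ (f x).length) →
      l.length ≤ (l.flatMap f).length := by
    intro α l f hf
    induction l with
    | nil => simp
    | cons x l ih =>
      have := hf x
      simp only [List.length_cons, List.flatMap_cons, List.length_append]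
      omega
  have h1 := key (C ℓ).gates Gate.encode fun x => by cases x <;> simp [Gate.encode]
  have h2 := key (C ℓ).outputs (fun i : Fin _ => Symbol.output :: ticks i) fun x => by simp
  simp only [Circuit.encode_eq, List.length_append, ticks, List.length_replicate] at hlen h2
  omega

/-- The circuits consist of nested loops over numbers of polynomial size, whose qubit numbers are
polynomials in the loop variables; so a generator writes them down. -/
theorem isUniformFamily_dotCircuit (b : Polynomial ℕ) :
    IsUniformFamily fun ℓ => dotCircuit (ℓ + 1) (2 * b.eval ℓ) := by
  refine isUniformFamily_of_writable ?_
  simp only [encode_dotCircuit]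
  have hn : Expressible fun ρ : Fin 1 → ℕ => ρ 0 + 1 := (Expressible.proj 0).add (.const 1)
  have hB : Expressible fun ρ : Fin 1 → ℕ => 2 * b.eval (ρ 0) :=
    (Expressible.const 2).mul (Expressible.polynomial_eval b (Expressible.proj 0))
  have hK := (Expressible.const 2).mul (hn.pow 3)
  have hD := hK.add ((Expressible.const 4).mul (hB.add (.const 1)))
  have hi : Expressible fun ρ : Fin 2 → ℕ => ρ (Fin.last 1) := Expressible.proj (Fin.last 1)
  have prep : OpsWritable fun ρ : Fin 1 → ℕ =>
      prepare (2 * (ρ 0 + 1) ^ 3 + 4 * (2 * b.eval (ρ 0) + 1)) :=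
    OpsWritable.flatMap_range (.const 5) (.had (hD.init.add hi) (.post (hD.init.add hi) .nil))
  exact ((hD.add (.const 5)).add hn : Expressible _).append ((Writable.append prep
    (Writable.flatMap_range hn (Writable.append
      (OpsWritable.stage hD.init hK.init hB.init hn.init hi)
      (.cons _ ((hD.init.add (.const 5)).add hi))))).append
    (Writable.flatMap_range hn (.cons _ ((hD.init.add (.const 5)).add hi))))

/-! ### The output -/

lemma Circuit.outputValue_mem_Icc (C : Circuit) (x : Fin C.width → Bool) :
    C.outputValue x ∈ Set.Icc (0 : ℝ) 1 := by
  rw [Circuit.outputValue]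
  induction C.outputs with
  | nil => simp
  | cons i l ih =>
    rw [List.foldr_cons]
    obtain ⟨h0, h1⟩ := ih
    constructor <;> split_ifs <;> linarith

lemma foldr_binary (b : ℕ → ℝ) (n : ℕ) (z : ℝ) :
    (List.range n).foldr (fun j v => (b j + v) / 2) z =
      ∑ j ∈ Finset.range n, b j * (1 / 2) ^ (j + 1) + z * (1 / 2) ^ n := by
  induction n generalizing z with
  | zero => simp
  | succ n ih =>
    rw [List.range_succ, List.foldr_append, ih, Finset.sum_range_succ]
    simp only [List.foldr_cons, List.foldr_nil]
    ring

lemma binaryValue_update (v : ℕ → Bool) (j : ℕ) (σ : Bool) :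
    binaryValue (Function.update v j σ) (j + 1) =
      binaryValue v j + (if σ then 1 else 0) * (1 / 2) ^ (j + 1) := by
  rw [← binaryValue_update_self v j σ, binaryValue, Finset.sum_range_succ, Function.update_self,
    binaryValue]

lemma binaryValue_mem_Icc (v : ℕ → Bool) (j : ℕ) :
    binaryValue v j ∈ Set.Icc (0 : ℝ) (1 - (1 / 2) ^ j) := by
  induction j with
  | zero => simp [binaryValue]
  | succ j ih =>
    have e : binaryValue v (j + 1) =
        binaryValue v j + (if v j then 1 else 0) * (1 / 2) ^ (j + 1) := Finset.sum_range_succ _ _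
    have h : (0 : ℝ) < (1 / 2) ^ j := by positivity
    rw [e, pow_succ]
    obtain ⟨h0, h1⟩ := ih
    constructor <;> split_ifs <;> linarith

lemma outputValue_dotCircuit {n B : ℕ} {v : ℕ → Bool} {x : Fin (dotCircuit n B).width → Bool}
    (h : ∀ s (hs : s < n), x ⟨2 * n ^ 3 + 4 * (B + 1) + 5 + s, by
      change _ < 2 * n ^ 3 + 4 * (B + 1) + 5 + n; omega⟩ = v s) :
    (dotCircuit n B).outputValue x = binaryValue v n := by
  have e := foldr_binary (fun s => if v s then 1 else 0) n 0
  rw [← List.map_coe_finRange_eq_range, List.foldr_map, zero_mul, add_zero] at e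
  rw [binaryValue, ← e, Circuit.outputValue]
  simp only [dotCircuit, List.foldr_map]
  congr 1
  funext j w
  have := h j j.2
  simp only [dotCircuit] at this
  rw [this]

/-! ### The input -/

/-- The bits of the description, continued by zeros. -/
def descBit {b : ℕ} (d : Fin 4 → FixedPoint b) (a : ℕ) : Bool := (descriptionBits d).getD a false

lemma descBit_eq {b : ℕ} (d : Fin 4 → FixedPoint b) (m : Fin 4) (r : Fin (2 * b + 1)) :
    descBit d (m * (2 * b + 1) + r) = d m r := by
  have h : (m : ℕ) * (2 * b + 1) + r = (finProdFinEquiv (m, r) : Fin (4 * (2 * b + 1))) := by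
    rw [finProdFinEquiv_apply_val]
    ring
  rw [descBit, descriptionBits, List.getD_eq_getElem?_getD, h, List.getElem?_ofFn,
    dif_pos (finProdFinEquiv (m, r)).2, Fin.eta, Equiv.symm_apply_apply, Option.getD_some]

lemma descBit_of_le {b : ℕ} (d : Fin 4 → FixedPoint b) {a : ℕ} (h : 4 * (2 * b + 1) ≤ a) :
    descBit d a = false := by
  rw [descBit, List.getD_eq_default]
  rwa [descriptionBits, List.length_ofFn]

/-- The number with real part (`c = false`) or imaginary part (`c = true`) of the coefficient of
`|κ⟩`, among the four numbers of a description. -/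
def part (c κ : Bool) : Fin 4 := ⟨2 * κ.toNat + c.toNat, by cases c <;> cases κ <;> simp⟩

lemma descNumber_descBit {b : ℕ} (d : Fin 4 → FixedPoint b) (c κ : Bool) :
    descNumber 0 (2 * b) (descBit d) c κ = 2 ^ b * (d (part c κ)).value := by
  have h : ∀ r : Fin (2 * b + 1),
      descBit d (descQubit 0 (2 * b) c κ r) = d (part c κ) r := by
    intro r
    rw [← descBit_eq d, descQubit, part, zero_add]
  have hl := h (Fin.last _)
  rw [Fin.val_last] at hl
  rw [descNumber, FixedPoint.value, hl, mul_left_comm]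
  congr 1
  rw [Finset.sum_range, Finset.mul_sum]
  refine Finset.sum_congr rfl fun r _ => ?_
  have hr := h r.castSucc
  rw [Fin.val_castSucc] at hr
  rw [hr]
  split_ifs
  · rw [zpow_sub₀ two_ne_zero, zpow_natCast, zpow_natCast]
    field_simp
  · simp

/-- As `γ` is real, real and imaginary part of the inner product are linear in the real and the
imaginary parts of the described vector. -/
lemma sum_descNumber {b : ℕ} (γ : Bool → ℝ) (d : Fin 4 → FixedPoint b) :
    ∑ c, (∑ κ, γ κ * descNumber 0 (2 * b) (descBit d) c κ) ^ 2 = 2 ^ (2 * b) *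
      ‖inner ℂ (!₂[(γ false : ℂ), (γ true : ℂ)] : Qubit) (describedVector d)‖ ^ 2 := by
  simp only [descNumber_descBit, Fintype.sum_bool, PiLp.inner_apply, Fin.sum_univ_two,
    Complex.sq_norm, Complex.normSq_apply, describedVector, part]
  simp
  ring

lemma inputState_eq {b : ℕ} (W K : ℕ) (γ : Bool → ℝ) (d : Fin 4 → FixedPoint b) :
    inputState W K !₂[(γ false : ℂ), (γ true : ℂ)] (descriptionBits d) =
      pstate W fun a => if a < K then realKet γ else ket (descBit d (a - K)) := by
  rw [realKet_eq]
  rfl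

/-! ### The binary search -/

/-- If in every stage at most one outcome leads out of the good histories `P`, and with probability
at most `δ`, then the run of the circuit ends in the event `E` but for probability `δ` per stage. In
particular, with `δ = 0` the run is well defined with probability `1`. -/
lemma le_outcomeProb_dotCircuit {n b : ℕ} (γ : Bool → ℝ) (hγ : ∑ κ, γ κ ^ 2 = 1)
    (d : Fin 4 → FixedPoint b) (E : Set (Fin (dotCircuit n (2 * b)).width → Bool))
    (P : ℕ → (ℕ → Bool) → Prop) {δ : ℝ} (hδ : 0 ≤ δ) (start : ∀ v, P 0 v)
    (step : ∀ j < n, ∀ v, P j v → (∀ σ, P (j + 1) (Function.update v j σ)) ∨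
      ∃ σ, P (j + 1) (Function.update v j σ) ∧ jumpProb n (‖inner ℂ
        (!₂[(γ false : ℂ), (γ true : ℂ)] : Qubit) (describedVector d)‖ ^ 2 -
          threshold v j) (!σ) ≤ δ)
    (final : ∀ v, P n v → ∀ x, (dotCircuit n (2 * b)).outputValue x = binaryValue v n → x ∈ E) :
    1 - n * δ ≤ outcomeProb (dotCircuit n (2 * b)).gates
      (inputState (dotCircuit n (2 * b)).width (2 * n ^ 3) !₂[(γ false : ℂ), (γ true : ℂ)]
        (descriptionBits d)) E := by
  obtain ⟨C, hC, h⟩ := run_prepare (W := (dotCircuit n (2 * b)).width)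
    (D := 2 * n ^ 3 + 4 * (2 * b + 1)) (K := 2 * n ^ 3)
    (by simp only [dotCircuit]; omega) (by omega) γ (descBit d)
    (fun a ha => descBit_of_le d (by omega)) (fun _ => false)
  have key := le_outcomeProb_stages (W := (dotCircuit n (2 * b)).width) rfl rfl le_rfl hγ
    (sum_descNumber γ d) E P hδ step (fun v hv x hx => final v hv x (outputValue_dotCircuit hx))
    n 0 (by omega) (fun _ => false) (start _)
  rw [zero_mul, zero_mul] at key
  rw [inputState_eq, show (dotCircuit n (2 * b)).gates = gatesOf (dotCircuit n (2 * b)).width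
    (prepare (2 * n ^ 3 + 4 * (2 * b + 1))) ++ stages (dotCircuit n (2 * b)).width
      (2 * n ^ 3 + 4 * (2 * b + 1)) (2 * n ^ 3) (2 * b) n 0 n from rfl, outcomeProb_gatesOf, h,
    outcomeProb_smul _ hC]
  exact key

/-- The first `j` bits `v` found in the search for `p` are right up to `ε`: the interval of the
numbers that start with them has distance at most `ε` from `p`. -/
def Close (p ε : ℝ) (j : ℕ) (v : ℕ → Bool) : Prop :=
  binaryValue v j - ε ≤ p ∧ p ≤ binaryValue v j + (1 / 2) ^ j + ε

/-- Far from the threshold a stage errs with small probability, and close to it both outcomes are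
acceptable. -/
lemma Close.step {ℓ j : ℕ} {p : ℝ} {v : ℕ → Bool} (h0 : 0 ≤ p) (h1 : p ≤ 1 + (1 / 2) ^ ℓ)
    (h : Close p ((1 / 2) ^ ℓ) j v) :
    (∀ σ, Close p ((1 / 2) ^ ℓ) (j + 1) (Function.update v j σ)) ∨
      ∃ σ, Close p ((1 / 2) ^ ℓ) (j + 1) (Function.update v j σ) ∧
        jumpProb (ℓ + 1) (p - threshold v j) (!σ) ≤ (1 / 9) ^ (ℓ + 1) := by
  have hℓ : ((1 : ℝ) / 2) ^ ℓ ≤ 1 := pow_le_one₀ (by norm_num) (by norm_num)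
  have hℓ0 : (0 : ℝ) < (1 / 2) ^ ℓ := by positivity
  have hj : (0 : ℝ) < (1 / 2) ^ j := by positivity
  have ht : threshold v j = binaryValue v j + (1 / 2) ^ (j + 1) := rfl
  obtain ⟨hb0, hb1⟩ := binaryValue_mem_Icc v j
  have hp : ((1 : ℝ) / 2) ^ (j + 1) = (1 / 2) ^ j * (1 / 2) := pow_succ _ _
  simp only [Close, binaryValue_update] at h ⊢
  rw [hp] at ht ⊢
  rcases le_total ((1 / 2) ^ ℓ) (p - threshold v j) with hx | hx
  · refine .inr ⟨true, ?_, jumpProb_false_le hx (by linarith)⟩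
    constructor <;> simp only [if_true] <;> linarith
  rcases le_total (p - threshold v j) (-(1 / 2) ^ ℓ) with hx' | hx'
  · refine .inr ⟨false, ?_, jumpProb_true_le hx' (by linarith)⟩
    constructor <;> simp only [if_false, Bool.false_eq_true] <;> linarith
  · refine .inl fun σ => ?_
    cases σ <;> constructor <;> simp only [if_true, if_false, Bool.false_eq_true] <;> linarith

lemma half_pow_le_rpow (ℓ : ℕ) : ((1 : ℝ) / 2) ^ ℓ ≤ 2 ^ (-(1 / 4 * ℓ : ℝ)) := by
  rw [one_div, inv_pow, ← Real.rpow_natCast, ← Real.rpow_neg zero_le_two]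
  exact Real.rpow_le_rpow_of_exponent_le one_le_two (by
    have : (0 : ℝ) ≤ ℓ := by positivity
    linarith)

/-- The accuracy of the search is `3 / 2 * 2 ^ (-ℓ)`; the constant `3 / 2` is absorbed by the weaker
exponent `ℓ / 4`, except for `ℓ = 0`. -/
lemma search_error_le {ℓ : ℕ} (hℓ : ℓ ≠ 0) :
    ((1 : ℝ) / 2) ^ (ℓ + 1) + (1 / 2) ^ ℓ ≤ 2 ^ (-(1 / 4 * ℓ : ℝ)) := by
  have h1 : (1 : ℝ) ≤ ℓ := by exact_mod_cast Nat.one_le_iff_ne_zero.2 hℓ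
  have h2 : (3 / 2 : ℝ) ≤ 2 ^ (3 / 4 * ℓ : ℝ) := by
    calc (3 / 2 : ℝ) ≤ 2 ^ (3 / 4 : ℝ) := by
          refine le_of_pow_le_pow_left₀ (n := 4) (by norm_num) (by positivity) ?_
          rw [← Real.rpow_natCast, ← Real.rpow_natCast, ← Real.rpow_mul zero_le_two]
          norm_num
      _ ≤ _ := Real.rpow_le_rpow_of_exponent_le one_le_two (by linarith)
  have h3 : (2 : ℝ) ^ (-(1 / 4 * ℓ : ℝ)) = 2 ^ (3 / 4 * ℓ : ℝ) * (1 / 2) ^ ℓ := by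
    rw [one_div 2, inv_pow, ← Real.rpow_natCast, ← Real.rpow_neg zero_le_two,
      ← Real.rpow_add zero_lt_two]
    congr 1
    ring
  rw [h3, pow_succ]
  nlinarith [show (0 : ℝ) < (1 / 2) ^ ℓ by positivity]

lemma failure_le (ℓ : ℕ) : ((ℓ + 1 : ℕ) : ℝ) * (1 / 9) ^ (ℓ + 1) ≤ (1 / 2) ^ ℓ := by
  have h1 : ((ℓ + 1 : ℕ) : ℝ) ≤ 2 ^ (ℓ + 1) := by exact_mod_cast (Nat.lt_two_pow_self).le
  calc ((ℓ + 1 : ℕ) : ℝ) * (1 / 9) ^ (ℓ + 1) ≤ 2 ^ (ℓ + 1) * (1 / 9) ^ (ℓ + 1) := by gcongr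
    _ = (2 / 9) ^ (ℓ + 1) := by rw [← mul_pow]; norm_num
    _ ≤ (1 / 2) ^ (ℓ + 1) := pow_le_pow_left₀ (by norm_num) (by norm_num) _
    _ ≤ (1 / 2) ^ ℓ := pow_le_pow_of_le_one (by norm_num) (by norm_num) (Nat.le_succ ℓ)

end PostBQP

theorem mainTheorem6 :
    ∃ c : ℝ, 0 < c ∧
      ∀ b : Polynomial ℕ, ∃ (k : Polynomial ℕ) (C : ℕ → PostBQP.Circuit),
        PostBQP.IsUniformFamily C ∧
        ∀ ℓ : ℕ,
          k.eval ℓ + 4 * (2 * b.eval ℓ + 1) ≤ (C ℓ).width ∧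
          (∀ x, (C ℓ).outputValue x ∈ Set.Icc (0 : ℝ) 1) ∧
          ∀ γ₁ γ₂ : ℝ, γ₁ ^ 2 + γ₂ ^ 2 = 1 →
            |γ₁| ∈ ({0} ∪ Set.Ioo ((2 : ℝ) ^ (-(ℓ : ℝ))) ((2 : ℝ) ^ (ℓ : ℝ)) : Set ℝ) →
            |γ₂| ∈ ({0} ∪ Set.Ioo ((2 : ℝ) ^ (-(ℓ : ℝ))) ((2 : ℝ) ^ (ℓ : ℝ)) : Set ℝ) →
            ∀ d : Fin 4 → PostBQP.FixedPoint (b.eval ℓ),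
              ‖inner ℂ (!₂[(γ₁ : ℂ), (γ₂ : ℂ)] : PostBQP.Qubit) (PostBQP.describedVector d)‖ ^ 2
                ≤ 1 + (2 : ℝ) ^ (-(ℓ : ℝ)) →
              PostBQP.outcomeProb (C ℓ).gates
                  (PostBQP.inputState (C ℓ).width (k.eval ℓ) !₂[(γ₁ : ℂ), (γ₂ : ℂ)]
                    (PostBQP.descriptionBits d)) Set.univ = 1 ∧
              1 - (2 : ℝ) ^ (-(c * ℓ)) ≤
                PostBQP.outcomeProb (C ℓ).gates
                  (PostBQP.inputState (C ℓ).width (k.eval ℓ) !₂[(γ₁ : ℂ), (γ₂ : ℂ)]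
                    (PostBQP.descriptionBits d))
                  {x | |(C ℓ).outputValue x -
                      ‖inner ℂ (!₂[(γ₁ : ℂ), (γ₂ : ℂ)] : PostBQP.Qubit)
                        (PostBQP.describedVector d)‖ ^ 2| ≤ (2 : ℝ) ^ (-(c * ℓ))} := by
  refine ⟨1 / 4, by norm_num, fun b => ⟨2 * (Polynomial.X + 1) ^ 3,
    fun ℓ => PostBQP.dotCircuit (ℓ + 1) (2 * b.eval ℓ), PostBQP.isUniformFamily_dotCircuit b,
    fun ℓ => ?_⟩⟩
  have hk : (2 * (Polynomial.X + 1) ^ 3 : Polynomial ℕ).eval ℓ = 2 * (ℓ + 1) ^ 3 := by simp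
  rw [hk]
  refine ⟨?_, PostBQP.Circuit.outputValue_mem_Icc _, fun γ₁ γ₂ hγ _ _ d hp => ?_⟩
  · simp only [PostBQP.dotCircuit]
    omega
  let γ : Bool → ℝ := fun κ => if κ then γ₂ else γ₁
  have hγ' : ∑ κ, γ κ ^ 2 = 1 := by simpa [γ, add_comm] using hγ
  rw [Real.rpow_neg zero_le_two, Real.rpow_natCast, ← inv_pow, ← one_div] at hp
  constructor
  · refine le_antisymm (PostBQP.outcomeProb_mem_Icc _ _ _).2 ?_
    have h := PostBQP.le_outcomeProb_dotCircuit (n := ℓ + 1) γ hγ' d Set.univ (fun _ _ => True)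
      (δ := 0) le_rfl (fun _ => trivial) (fun _ _ _ _ => .inl fun _ => trivial)
      (fun _ _ _ _ => trivial)
    rw [mul_zero, sub_zero] at h
    exact h
  · -- for `ℓ = 0` the bound on the probability is trivial, while the search may be off by `3 / 2`
    rcases eq_or_ne ℓ 0 with rfl | hℓ
    · simpa using (PostBQP.outcomeProb_mem_Icc _ _ _).1
    refine le_trans ?_ (PostBQP.le_outcomeProb_dotCircuit (n := ℓ + 1) γ hγ' d _
      (PostBQP.Close (‖inner ℂ (!₂[(γ₁ : ℂ), (γ₂ : ℂ)] : PostBQP.Qubit)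
        (PostBQP.describedVector d)‖ ^ 2) ((1 / 2) ^ ℓ)) (δ := (1 / 9) ^ (ℓ + 1)) (by positivity)
      (fun v => ?_) (fun j _ v hv => PostBQP.Close.step (by positivity) hp hv)
      (fun v hv x hx => ?_))
    · have h1 := PostBQP.failure_le ℓ
      have h2 := PostBQP.half_pow_le_rpow ℓ
      linarith
    · constructor
      · have : (0 : ℝ) < (1 / 2) ^ ℓ := by positivity
        simp only [PostBQP.binaryValue, Finset.range_zero, Finset.sum_empty]
        nlinarith [norm_nonneg (inner ℂ (!₂[(γ₁ : ℂ), (γ₂ : ℂ)] : PostBQP.Qubit)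
          (PostBQP.describedVector d))]
      · simpa [PostBQP.binaryValue] using hp
    · have h := PostBQP.search_error_le hℓ
      obtain ⟨h1, h2⟩ := hv
      rw [Set.mem_ofPred_eq, hx, abs_le]
      constructor <;> linarith [show (0 : ℝ) < (1 / 2) ^ (ℓ + 1) by positivity]
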